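/- A \emph{finite quantum graph} $F$ is a metric graph with finitely many edges $e$ of lengths $\ell_e\in(0,\infty)$ (loops and multiple edges allowed), with a measure $\mu$ that on each connected component is a positive constant multiple of the length measure. Its \emph{Kirchhoff Laplacian} is the operator $f\mapsto -f''$ in $L^2(F,\mu)$ (real or complex scalars $\mathbb K$) whose domain consists of those functions $f$ on $F$ (single valued at the vertices) that lie in the Sobolev space $H^2$ of each edge and whose outgoing first derivatives along all edge ends at each vertex sum to zero. Let $(F_n,\phi_{n+1,n})_{n\ge 0}$ be a projective system of finite quantum graphs: $\phi_{n+1,n}:F_{n+1}\to F_n$ is continuous and surjective, and maps $\mu_{n+1}$ to $\mu_n$. Let $L=\varprojlim F_n$ with projections $\Phi_n:L\to F_n$, let $\mu$ be the limit measure on $L$ (so $\Phi_n$ maps $\mu$ to $\mu_n$ for every $n$), and let $\mathcal H=L^2(L,\mu)$. Let $A_n$ also denote the Kirchhoff Laplacian of $F_n$ pulled back to $\mathcal H$: its domain is $\mathcal D_n=\{f\circ\Phi_n : f\in \mathrm{Dom}(A_n)\}$ and $A_n(f\circ\Phi_n)=(A_nf)\circ\Phi_n$. Let $A$ be the projective limit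 of the $A_n$, that is, the smallest self-adjoint operator in $\mathcal H$ that extends every $A_n$. Put $$\mathcal D_0'=\mathcal D_0,\qquad \mathcal D_n'=\mathcal D_{n-1}^{\perp}\cap\mathcal D_n\quad(n\ge1),$$ the orthogonal complement being taken in $\mathcal H$. Then: 1. The spaces $\mathcal D'_n$ are pairwise orthogonal and their algebraic sum is $\bigoplus_n\mathcal D'_n=\bigcup_n\mathcal D_n$. This union is dense in $\mathrm{Dom}(A)$ for the graph norm; more precisely, the graph of $A$ is the closure in $\mathcal H\times\mathcal H$ of the union of the graphs of the $A_n$. 2. $A_n$ maps $\mathcal D'_n$ into $\overline{\mathcal D'_n}$. Let $\sigma(A_n|_{\mathcal D'_n})$ be the spectrum of $A_n|_{\mathcal D'_n}$ as an operator in the Hilbert space $\overline{\mathcal D'_n}$. The set $\sigma_p(A)$ of eigenvalues of $A$ is $$\sigma_p(A)=\bigcup_{n=0}^\infty\sigma\big(A_n|_{\mathcal D'_n}\big),$$ and multiplicities add: for every $\lambda\in\mathbb K$, $$\dim\ker(A-\lambda)=\sum_{n=0}^\infty\dim\ker\big(A_n|_{\mathcal D'_n}-\lambda\big)\in\{0,1,2,\dots\}\cup\{\infty\}.$$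 3. The full spectrum of $A$ (the complement of its resolvent set) is $\sigma(A)=\overline{\bigcup_{n}\sigma(A_n|_{\mathcal D'_n})}$; in particular $\sigma(A)=\bigcup_n\sigma(A_n|_{\mathcal D_n'})$ whenever this union is closed. -/

import Mathlib

open MeasureTheory Set Filter Topology
open scoped ENNReal InnerProductSpace

universe u

/-! ### Metric graphs and their Kirchhoff Laplacians -/

/-- The data of a finite quantum graph: vertices, finitely many edges `e` with end vertices
`src e`, `tgt e` (loops and multiple edges are allowed), a length `length e > 0`, and the density
`weight e > 0` of the measure with respect to length on `e`.  The density is the same on edges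
that share a vertex, so the measure is, on each connected component, a positive constant multiple
of the length measure. -/
structure QuantumGraph : Type (u + 1) where
  V : Type u
  E : Type u
  fintypeE : Fintype E
  src : E → V
  tgt : E → V
  length : E → ℝ
  length_pos : ∀ e, 0 < length e
  weight : E → ℝ
  weight_pos : ∀ e, 0 < weight e
  weight_eq : ∀ e e', (src e = src e' ∨ src e = tgt e' ∨ tgt e = src e' ∨ tgt e = tgt e') →
    weight e = weight e'

namespace QuantumGraph

attribute [instance] QuantumGraph.fintypeE

variable (G : QuantumGraph.{u})

/-- The disjoint union of the closed segments `[0, length e]`. -/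
abbrev Segments : Type u := Σ e : G.E, Icc (0 : ℝ) (G.length e)

/-- The point `x` of the disjoint union of segments is an end point placed at the vertex `v`. -/
def IsAt (v : G.V) (x : G.Segments) : Prop :=
  ((x.2 : ℝ) = 0 ∧ G.src x.1 = v) ∨ ((x.2 : ℝ) = G.length x.1 ∧ G.tgt x.1 = v)

theorem IsAt.unique {v w : G.V} {x : G.Segments} (hv : G.IsAt v x) (hw : G.IsAt w x) :
    v = w := by
  have := G.length_pos x.1
  rcases hv with ⟨h1, rfl⟩ | ⟨h1, rfl⟩ <;> rcases hw with ⟨h2, rfl⟩ | ⟨h2, rfl⟩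
  · rfl
  · linarith
  · linarith
  · rfl

/-- Glue end points of segments that are placed at the same vertex. -/
def glue : Setoid G.Segments where
  r x y := x = y ∨ ∃ v, G.IsAt v x ∧ G.IsAt v y
  iseqv :=
    { refl := fun _ => Or.inl rfl
      symm := by
        rintro x y (rfl | ⟨v, h1, h2⟩)
        · exact Or.inl rfl
        · exact Or.inr ⟨v, h2, h1⟩
      trans := by
        rintro x y z (rfl | ⟨v, h1, h2⟩) h
        · exact h
        · rcases h with rfl | ⟨w, h3, h4⟩
          · exact Or.inr ⟨v, h1, h2⟩
          · obtain rfl := IsAt.unique G h2 h3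
            exact Or.inr ⟨v, h1, h4⟩ }

/-- The space of points of the metric graph, with the quotient topology and its Borel sets.
(Isolated vertices contribute no point.) -/
def Point : Type u := Quotient G.glue

instance : TopologicalSpace G.Point :=
  inferInstanceAs (TopologicalSpace (Quotient G.glue))

instance : MeasurableSpace G.Point := borel _

instance : BorelSpace G.Point := ⟨rfl⟩

/-- The arc-length parametrization `[0, length e] → G.Point` of the edge `e`
(constant outside that interval). -/
noncomputable def param (e : G.E) (t : ℝ) : G.Point :=
  Quotient.mk G.glue ⟨e, projIcc 0 (G.length e) (G.length_pos e).le t⟩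

theorem continuous_param (e : G.E) : Continuous (G.param e) :=
  continuous_quotient_mk'.comp (continuous_sigmaMk.comp continuous_projIcc)

/-- The measure on the metric graph: `weight e` times the length measure on each edge `e`. -/
noncomputable def measure : Measure G.Point :=
  ∑ e : G.E, ENNReal.ofReal (G.weight e) •
    (volume.restrict (Icc (0 : ℝ) (G.length e))).map (G.param e)

theorem smul_map_param_le (e : G.E) :
    ENNReal.ofReal (G.weight e) •
      (volume.restrict (Icc (0 : ℝ) (G.length e))).map (G.param e) ≤ G.measure := by
  refine Measure.le_iff.2 fun s _ => ?_
  unfold measure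
  rw [Measure.finsetSum_apply]
  exact Finset.single_le_sum
    (f := fun e : G.E => (ENNReal.ofReal (G.weight e) •
      (volume.restrict (Icc (0 : ℝ) (G.length e))).map (G.param e)) s)
    (fun _ _ => zero_le) (Finset.mem_univ e)

theorem map_param_absolutelyContinuous (e : G.E) :
    (volume.restrict (Icc (0 : ℝ) (G.length e))).map (G.param e) ≪ G.measure := by
  have hw : ENNReal.ofReal (G.weight e) ≠ 0 := by
    simpa using G.weight_pos e
  refine (Measure.absolutelyContinuous_smul hw).trans ?_
  exact Measure.absolutelyContinuous_of_le (G.smul_map_param_le e)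

theorem ae_param {P : G.Point → Prop} (h : ∀ᵐ x ∂G.measure, P x) (e : G.E) :
    ∀ᵐ t ∂(volume.restrict (Icc (0 : ℝ) (G.length e))), P (G.param e t) :=
  ae_of_ae_map (G.continuous_param e).measurable.aemeasurable
    ((G.map_param_absolutelyContinuous e).ae_le h)

theorem ae_of_ae_param {P : G.Point → Prop} (hP : MeasurableSet {x | P x})
    (h : ∀ e, ∀ᵐ t ∂(volume.restrict (Icc (0 : ℝ) (G.length e))), P (G.param e t)) :
    ∀ᵐ x ∂G.measure, P x := by
  rw [ae_iff]
  unfold measure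
  rw [Measure.finsetSum_apply]
  refine Finset.sum_eq_zero fun e _ => ?_
  rw [Measure.smul_apply]
  have := (ae_map_iff (G.continuous_param e).measurable.aemeasurable hP).2 (h e)
  rw [ae_iff] at this
  rw [this, smul_zero]

variable {𝕜 : Type*} [RCLike 𝕜]

theorem intervalIntegrable_param (h : Lp 𝕜 2 G.measure) (e : G.E) {a b : ℝ}
    (ha : a ∈ Icc 0 (G.length e)) (hb : b ∈ Icc 0 (G.length e)) :
    IntervalIntegrable (fun s => h (G.param e s)) volume a b := by
  have h1 : MemLp h 2 ((volume.restrict (Icc (0 : ℝ) (G.length e))).map (G.param e)) := by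
    have hw : ENNReal.ofReal (G.weight e) ≠ 0 := by
      simpa using G.weight_pos e
    have h2 : MemLp h 2 (ENNReal.ofReal (G.weight e) •
        (volume.restrict (Icc (0 : ℝ) (G.length e))).map (G.param e)) :=
      (Lp.memLp h).mono_measure (G.smul_map_param_le e)
    have h3 := h2.smul_measure (c := (ENNReal.ofReal (G.weight e))⁻¹)
      (ENNReal.inv_ne_top.2 hw)
    rwa [smul_smul, ENNReal.inv_mul_cancel hw ENNReal.ofReal_ne_top, one_smul] at h3
  have h4 : MemLp (fun s => h (G.param e s)) 2
      (volume.restrict (Icc (0 : ℝ) (G.length e))) :=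
    h1.comp_of_map (G.continuous_param e).measurable.aemeasurable
  have h5 : IntegrableOn (fun s => h (G.param e s)) (Icc (0 : ℝ) (G.length e)) :=
    h4.integrable (by norm_num)
  rw [intervalIntegrable_iff]
  exact h5.mono_set (uIoc_subset_uIcc.trans (uIcc_subset_Icc ha hb))

open Classical in
/-- `g` lies in the domain of the Kirchhoff Laplacian and `h = -g''`.  Here `g` is a function on
the graph (hence single valued at the vertices), `p e` is the derivative of `g` along the edge `e`
(one-sided at the ends), `p e` is absolutely continuous with derivative `-h` almost everywhere,
and at each vertex `v` the derivatives in the directions leaving `v` along all incident edge ends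
sum to zero.  With `h` square integrable, this says that `g` is in the Sobolev space `H²` of each
edge. -/
def IsLaplacePair (g h : G.Point → 𝕜) : Prop :=
  ∃ p : G.E → ℝ → 𝕜,
    (∀ e, ∀ t ∈ Icc 0 (G.length e),
      HasDerivWithinAt (fun s => g (G.param e s)) (p e t) (Icc 0 (G.length e)) t) ∧
    (∀ e, ∀ t ∈ Icc 0 (G.length e), p e t = p e 0 - ∫ s in (0 : ℝ)..t, h (G.param e s)) ∧
    (∀ v : G.V, (∑ e : G.E, if G.src e = v then p e 0 else 0) +
      (∑ e : G.E, if G.tgt e = v then -p e (G.length e) else 0) = 0)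

/-- The graph `{(f, -f'') : f ∈ Dom}` of the Kirchhoff Laplacian in `L²`. -/
noncomputable def laplacianGraph (𝕜 : Type*) [RCLike 𝕜] :
    Submodule 𝕜 (Lp 𝕜 2 G.measure × Lp 𝕜 2 G.measure) where
  carrier := {x | ∃ g : G.Point → 𝕜, x.1 =ᵐ[G.measure] g ∧ G.IsLaplacePair g x.2}
  zero_mem' := by
    refine ⟨0, Lp.coeFn_zero _ _ _, fun _ _ => 0, ?_, ?_, ?_⟩
    · intro e t _
      exact hasDerivWithinAt_const _ _ _
    · intro e t ht
      have : ∫ s in (0 : ℝ)..t, (0 : Lp 𝕜 2 G.measure) (G.param e s) = ∫ s in (0 : ℝ)..t, (0 : 𝕜) := by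
        refine intervalIntegral.integral_congr_ae_restrict ?_
        have := G.ae_param (Lp.coeFn_zero 𝕜 2 G.measure) e
        refine ae_restrict_of_ae_restrict_of_subset ?_ this
        exact uIoc_subset_uIcc.trans (uIcc_subset_Icc ⟨le_rfl, (G.length_pos e).le⟩ ht)
      simpa using this
    · intro v
      simp
  add_mem' := by
    rintro ⟨f, h⟩ ⟨f', h'⟩ ⟨g, hg, p, hp1, hp2, hp3⟩ ⟨g', hg', p', hp1', hp2', hp3'⟩
    refine ⟨g + g', (Lp.coeFn_add f f').trans (hg.add hg'), fun e t => p e t + p' e t, ?_, ?_, ?_⟩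
    · intro e t ht
      exact (hp1 e t ht).add (hp1' e t ht)
    · intro e t ht
      have h0 : (0 : ℝ) ∈ Icc 0 (G.length e) := ⟨le_rfl, (G.length_pos e).le⟩
      have : ∫ s in (0 : ℝ)..t, (h + h' : Lp 𝕜 2 G.measure) (G.param e s) =
          ∫ s in (0 : ℝ)..t, (h (G.param e s) + h' (G.param e s)) := by
        refine intervalIntegral.integral_congr_ae_restrict ?_
        have := G.ae_param (Lp.coeFn_add h h') e
        refine ae_restrict_of_ae_restrict_of_subset ?_ this
        exact uIoc_subset_uIcc.trans (uIcc_subset_Icc h0 ht)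
      rw [intervalIntegral.integral_add (G.intervalIntegrable_param h e h0 ht)
        (G.intervalIntegrable_param h' e h0 ht)] at this
      change p e t + p' e t = p e 0 + p' e 0 -
        ∫ s in (0 : ℝ)..t, (h + h' : Lp 𝕜 2 G.measure) (G.param e s)
      rw [this, hp2 e t ht, hp2' e t ht]
      ring
    · intro v
      have := congrArg₂ (fun a b : 𝕜 => a + b) (hp3 v) (hp3' v)
      beta_reduce at this
      rw [add_zero, add_add_add_comm, ← Finset.sum_add_distrib, ← Finset.sum_add_distrib] at this
      refine Eq.trans ?_ this
      congr 1 <;> refine Finset.sum_congr rfl fun e _ => ?_ <;> split_ifs <;> ring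
  smul_mem' := by
    rintro c ⟨f, h⟩ ⟨g, hg, p, hp1, hp2, hp3⟩
    refine ⟨c • g, (Lp.coeFn_smul c f).trans (hg.const_smul c), fun e t => c * p e t, ?_, ?_, ?_⟩
    · intro e t ht
      exact (hp1 e t ht).const_mul c
    · intro e t ht
      have h0 : (0 : ℝ) ∈ Icc 0 (G.length e) := ⟨le_rfl, (G.length_pos e).le⟩
      have : ∫ s in (0 : ℝ)..t, (c • h : Lp 𝕜 2 G.measure) (G.param e s) =
          ∫ s in (0 : ℝ)..t, c * h (G.param e s) := by
        refine intervalIntegral.integral_congr_ae_restrict ?_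
        have := G.ae_param (Lp.coeFn_smul c h) e
        refine ae_restrict_of_ae_restrict_of_subset ?_ this
        exact uIoc_subset_uIcc.trans (uIcc_subset_Icc h0 ht)
      rw [intervalIntegral.integral_const_mul] at this
      change c * p e t = c * p e 0 - ∫ s in (0 : ℝ)..t, (c • h : Lp 𝕜 2 G.measure) (G.param e s)
      rw [this, hp2 e t ht]
      ring
    · intro v
      have := congrArg (c * ·) (hp3 v)
      simp only [mul_add, Finset.mul_sum, mul_zero] at this
      refine Eq.trans ?_ this
      congr 1 <;> refine Finset.sum_congr rfl fun e _ => ?_ <;> split_ifs <;> ring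

/-- The Kirchhoff Laplacian `f ↦ -f''`, as an unbounded operator on `L²` of the graph. -/
noncomputable def laplacian (𝕜 : Type*) [RCLike 𝕜] :
    Lp 𝕜 2 G.measure →ₗ.[𝕜] Lp 𝕜 2 G.measure :=
  (G.laplacianGraph 𝕜).toLinearPMap

/-- The value `-f''` is determined by `f`. -/
theorem laplacianGraph_singleValued (x : Lp 𝕜 2 G.measure × Lp 𝕜 2 G.measure)
    (hx : x ∈ G.laplacianGraph 𝕜) (hx0 : x.1 = 0) : x.2 = 0 := by
  obtain ⟨f, h⟩ := x
  obtain ⟨g, hg, p, hp1, hp2, -⟩ := hx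
  change f = 0 at hx0
  subst hx0
  change h = 0
  have hg0 : ∀ᵐ y ∂G.measure, g y = 0 := by
    filter_upwards [hg, Lp.coeFn_zero 𝕜 2 G.measure] with y h1 h2
    rw [← h1, h2, Pi.zero_apply]
  have key : ∀ e, ∀ᵐ t ∂(volume.restrict (Icc (0 : ℝ) (G.length e))),
      h (G.param e t) = 0 := by
    intro e
    have hl := G.length_pos e
    have hcont : ContinuousOn (fun s => g (G.param e s)) (Icc 0 (G.length e)) :=
      fun t ht => (hp1 e t ht).continuousWithinAt
    have hz : EqOn (fun s => g (G.param e s)) (fun _ => 0) (Icc 0 (G.length e)) :=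
      Measure.eqOn_Icc_of_ae_eq volume hl.ne (G.ae_param hg0 e) hcont continuousOn_const
    have hp0 : ∀ t ∈ Icc 0 (G.length e), p e t = 0 := by
      intro t ht
      have h1 : HasDerivWithinAt (fun s => g (G.param e s)) 0 (Icc 0 (G.length e)) t :=
        (hasDerivWithinAt_const t (Icc 0 (G.length e)) (0 : 𝕜)).congr hz (hz ht)
      exact (uniqueDiffOn_Icc hl t ht).eq_deriv _ (hp1 e t ht) h1
    have hI : ∀ t ∈ Icc 0 (G.length e), ∫ s in (0 : ℝ)..t, h (G.param e s) = 0 := by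
      intro t ht
      have := hp2 e t ht
      rw [hp0 t ht, hp0 0 ⟨le_rfl, hl.le⟩, zero_sub, zero_eq_neg] at this
      exact this
    have hint := G.intervalIntegrable_param h e (a := 0) (b := G.length e)
      ⟨le_rfl, hl.le⟩ ⟨hl.le, le_rfl⟩
    have h1 := hint.ae_hasDerivAt_integral
    have hne : ∀ᵐ t : ℝ, t ≠ 0 ∧ t ≠ G.length e := by
      have a1 : ∀ᵐ t : ℝ, t ≠ 0 := Measure.ae_ne volume 0
      have a2 : ∀ᵐ t : ℝ, t ≠ G.length e := Measure.ae_ne volume (G.length e)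
      filter_upwards [a1, a2] with t h1 h2 using ⟨h1, h2⟩
    rw [ae_restrict_iff' measurableSet_Icc]
    filter_upwards [h1, hne] with t ht hne htI
    have htt : t ∈ Ioo 0 (G.length e) :=
      ⟨lt_of_le_of_ne htI.1 hne.1.symm, lt_of_le_of_ne htI.2 hne.2⟩
    have hd := ht (by rw [uIcc_of_le hl.le]; exact htI) 0 (by rw [uIcc_of_le hl.le]; exact ⟨le_rfl, hl.le⟩)
    have hev : (fun x => ∫ s in (0 : ℝ)..x, h (G.param e s)) =ᶠ[𝓝 t] fun _ => 0 := by
      filter_upwards [Icc_mem_nhds htt.1 htt.2] with x hx using hI x hx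
    exact hd.unique ((hasDerivAt_const t (0 : 𝕜)).congr_of_eventuallyEq hev)
  have hae : ∀ᵐ y ∂G.measure, (h : G.Point → 𝕜) y = 0 :=
    G.ae_of_ae_param ((Lp.stronglyMeasurable h).measurable (measurableSet_singleton 0)) key
  exact (Lp.eq_zero_iff_ae_eq_zero).2 hae

theorem graph_laplacian : (G.laplacian 𝕜).graph = G.laplacianGraph 𝕜 :=
  Submodule.toLinearPMap_graph_eq _ G.laplacianGraph_singleValued

end QuantumGraph

/-! ### Projective systems of quantum graphs -/

/-- A projective system of quantum graphs `F 0 ← F 1 ← F 2 ← ⋯`: the bonding maps are continuous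
surjections compatible with the measures. -/
structure QuantumGraphSystem : Type (u + 1) where
  F : ℕ → QuantumGraph.{u}
  map : ∀ n, (F (n + 1)).Point → (F n).Point
  continuous_map : ∀ n, Continuous (map n)
  surjective_map : ∀ n, Function.Surjective (map n)
  measurePreserving_map : ∀ n, MeasurePreserving (map n) (F (n + 1)).measure (F n).measure

namespace QuantumGraphSystem

variable (S : QuantumGraphSystem.{u})

/-- The projective limit space, a subspace of the product of the `F n`; it carries the subspace
topology and the σ-algebra generated by the coordinate projections. -/
abbrev Limit : Type u := {x : ∀ n, (S.F n).Point // ∀ n, S.map n (x (n + 1)) = x n}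

/-- The projection of the limit space to `F n`. -/
def proj (n : ℕ) (x : S.Limit) : (S.F n).Point := x.1 n

/-- `μ` is the limit measure: its image under every projection is the measure of `F n`. -/
def IsLimitMeasure (μ : Measure S.Limit) : Prop :=
  ∀ n, MeasurePreserving (S.proj n) μ (S.F n).measure

end QuantumGraphSystem

/-! ### Unbounded operators -/

section Operators

variable {𝕜 : Type*} [RCLike 𝕜] {H K : Type*} [NormedAddCommGroup H] [InnerProductSpace 𝕜 H]
  [NormedAddCommGroup K] [InnerProductSpace 𝕜 K]

/-- Transport of an operator `T` on `K` along an isometric embedding `U : K → H`: the domain is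
`U (Dom T)` and `U f ↦ U (T f)`. -/
noncomputable def transportOp (U : K →ₗᵢ[𝕜] H) (T : K →ₗ.[𝕜] K) : H →ₗ.[𝕜] H where
  domain := T.domain.map U.toLinearMap
  toFun := U.toLinearMap ∘ₗ T.toFun ∘ₗ
    (Submodule.equivMapOfInjective U.toLinearMap U.injective T.domain).symm.toLinearMap

/-- The resolvent set of `T`, as a densely defined operator in the Hilbert space
`closure (Dom T)`: those `z` for which `T - z` is a bijection of `Dom T` onto `closure (Dom T)`
with bounded inverse. (If `Dom T` is dense this is the usual notion.) -/
def opResolventSet (T : H →ₗ.[𝕜] H) : Set 𝕜 :=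
  {z | BijOn (fun x : T.domain => T x - z • (x : H)) univ
      (T.domain.topologicalClosure : Set H) ∧
    ∃ C : ℝ, ∀ x : T.domain, ‖(x : H)‖ ≤ C * ‖T x - z • (x : H)‖}

/-- The spectrum of `T`, as an operator in the Hilbert space `closure (Dom T)`. -/
def opSpectrum (T : H →ₗ.[𝕜] H) : Set 𝕜 := (opResolventSet T)ᶜ

/-- The eigenspace `{x ∈ Dom T : T x = z x}`. -/
def opEigenspace (T : H →ₗ.[𝕜] H) (z : 𝕜) : Submodule 𝕜 H :=
  (LinearMap.ker (T.toFun - z • T.domain.subtype)).map T.domain.subtype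

/-- The set of eigenvalues of `T`. -/
def opEigenvalues (T : H →ₗ.[𝕜] H) : Set 𝕜 := {z | opEigenspace T z ≠ ⊥}

/-- The multiplicity of `z` as an eigenvalue of `T`: the dimension of the eigenspace. -/
noncomputable def opMultiplicity (T : H →ₗ.[𝕜] H) (z : 𝕜) : ℕ∞ :=
  Cardinal.toENat (Module.rank 𝕜 (opEigenspace T z))

/-- `A` is the projective limit of the operators `T n`: the smallest self-adjoint operator that
extends all of them. -/
structure IsProjectiveLimitOp [CompleteSpace H] (T : ℕ → H →ₗ.[𝕜] H) (A : H →ₗ.[𝕜] H) :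
    Prop where
  isSelfAdjoint : IsSelfAdjoint A
  le : ∀ n, T n ≤ A
  minimal : ∀ B : H →ₗ.[𝕜] H, IsSelfAdjoint B → (∀ n, T n ≤ B) → A ≤ B

/-- The orthogonalized domains `D' 0 = D 0`, `D' (n+1) = (D n)ᗮ ∩ D (n+1)`. -/
def orthoDomain (D : ℕ → Submodule 𝕜 H) : ℕ → Submodule 𝕜 H
  | 0 => D 0
  | n + 1 => (D n)ᗮ ⊓ D (n + 1)

end Operators

namespace QuantumGraphSystem

variable (S : QuantumGraphSystem.{u}) (𝕜 : Type*) [RCLike 𝕜] {μ : Measure S.Limit}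
  (hμ : S.IsLimitMeasure μ)

/-- The Kirchhoff Laplacian of `F n` pulled back to `L²` of the limit space: its domain is
`{f ∘ proj n : f ∈ Dom}`, and `f ∘ proj n ↦ (-f'') ∘ proj n`. -/
noncomputable def pullbackLaplacian (n : ℕ) : Lp 𝕜 2 μ →ₗ.[𝕜] Lp 𝕜 2 μ :=
  transportOp (Lp.compMeasurePreservingₗᵢ 𝕜 (S.proj n) (hμ n)) ((S.F n).laplacian 𝕜)

/-- The orthogonalized domain `D' n` in `L²` of the limit space. -/
noncomputable def orthoDom (n : ℕ) : Submodule 𝕜 (Lp 𝕜 2 μ) :=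
  orthoDomain (fun k => (S.pullbackLaplacian 𝕜 hμ k).domain) n

/-- The restriction of the (pulled back) Kirchhoff Laplacian of `F n` to `D' n`. -/
noncomputable def restrictedLaplacian (n : ℕ) : Lp 𝕜 2 μ →ₗ.[𝕜] Lp 𝕜 2 μ :=
  (S.pullbackLaplacian 𝕜 hμ n).domRestrict (S.orthoDom 𝕜 hμ n)

end QuantumGraphSystem

/-!
The proof has an operator-theoretic half, which only uses that a self-adjoint operator `A` is
exhausted by nonnegative operators with compact resolvent (`OpExhaustion`), and an analytic half,
which shows that the Kirchhoff Laplacians of finite quantum graphs are such operators.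

*Operators.* The operators `T n + 1` map onto closed subspaces `K n` with dense union.  Hence the
kernel of `A + 1`, which is orthogonal to its range, is trivial, so `T n` is the part of `A` for
which `(A + 1) x` lies in `K n`; in particular the `T n` increase.  By nonnegativity `A + 1` is
bounded below on the union of the `T n`, so its restriction to the closure of this union is onto,
and the closure is all of `A` (`OpExhaustion.graph_eq_closure`).  Thus `A` has a bounded resolvent
`R = (A + 1)⁻¹`, the domain of `T n` is `R (K n)`, and the orthogonalized domain is `R (K' n)`,
where `K' n` is the orthogonal complement of `K (n - 1)` in `K n`.  Since `R` leaves `K' n`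
invariant and is compact there, the spectral theorem for compact self-adjoint operators makes the
eigenvectors total in `K' n`, and compactness of the graph norm ball makes the set of eigenvalues
closed.  For a closed symmetric operator with a total set of eigenvectors the spectrum is the
closure of the set of eigenvalues (`opSpectrum_eq_closure_opEigenvalues`); this gives the spectrum
of each restriction and that of `A`.  The projections onto the `K' n` preserve the eigenspaces of
`A`, so that dimensions add (`toENat_rank_eq_tsum`).

*Quantum graphs.* Integration by parts together with the Kirchhoff condition gives the energy
identity `⟨-f'', f⟩ = ∫ |f'|²` (`IsLaplaceTriple.re_inner_eq`), hence nonnegativity, and also a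
Hölder bound on the unit ball of the graph norm, which is therefore relatively compact by the
Arzelà–Ascoli theorem.  To solve `-u'' + u = h` one solves the equation on each edge by variation
of parameters; the initial values and the vertex values then have to satisfy a square linear
system, which is injective by nonnegativity, hence solvable.

*The limit space.* The functions that factor through some `F n` are dense in `L²`, since the
cylinder sets form a π-system that generates the σ-algebra.
-/

/-! ### Graphs, eigenspaces and spectra of unbounded operators -/

section Operators

variable {𝕜 : Type*} [RCLike 𝕜] {H : Type*} [NormedAddCommGroup H] [InnerProductSpace 𝕜 H]

theorem mem_opEigenspace_iff {T : H →ₗ.[𝕜] H} {z : 𝕜} {x : H} :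
    x ∈ opEigenspace T z ↔ (x, z • x) ∈ T.graph := by
  rw [opEigenspace, Submodule.mem_map, LinearPMap.mem_graph_iff]
  constructor
  · rintro ⟨y, hy, rfl⟩
    refine ⟨y, rfl, ?_⟩
    rw [LinearMap.mem_ker] at hy
    simpa [sub_eq_zero] using hy
  · rintro ⟨y, hy, h⟩
    refine ⟨y, ?_, hy⟩
    rw [LinearMap.mem_ker]
    have h' : T y = z • x := h
    have hy' : (y : H) = x := hy
    simp only [LinearMap.sub_apply, LinearMap.smul_apply, Submodule.subtype_apply, hy', sub_eq_zero]
    exact h'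

theorem mem_graph_apply {T : H →ₗ.[𝕜] H} {x x' : H} (h : (x, x') ∈ T.graph) :
    ∃ y : T.domain, (y : H) = x ∧ T y = x' := by
  simpa using (LinearPMap.mem_graph_iff T).1 h

/-- Membership in the resolvent set, in terms of the graph. -/
theorem mem_opResolventSet_iff {T : H →ₗ.[𝕜] H} {z : 𝕜} :
    z ∈ opResolventSet T ↔
      (∀ p ∈ T.graph, p.2 - z • p.1 ∈ T.domain.topologicalClosure) ∧
      (∀ y ∈ T.domain.topologicalClosure, ∃ p ∈ T.graph, p.2 - z • p.1 = y) ∧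
      ∃ C : ℝ, ∀ p ∈ T.graph, ‖p.1‖ ≤ C * ‖p.2 - z • p.1‖ := by
  constructor
  · rintro ⟨hbij, C, hC⟩
    refine ⟨?_, ?_, C, ?_⟩
    · rintro ⟨x, x'⟩ hx
      obtain ⟨y, rfl, rfl⟩ := mem_graph_apply hx
      exact hbij.mapsTo (mem_univ y)
    · intro y hy
      obtain ⟨x, -, hx⟩ := hbij.surjOn hy
      exact ⟨_, T.mem_graph x, hx⟩
    · rintro ⟨x, x'⟩ hx
      obtain ⟨y, rfl, rfl⟩ := mem_graph_apply hx
      exact hC y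
  · rintro ⟨h1, h2, C, hC⟩
    refine ⟨⟨fun x _ => h1 _ (T.mem_graph x), fun x _ y _ hxy => ?_, fun y hy => ?_⟩, C,
      fun x => hC _ (T.mem_graph x)⟩
    · have h := hC _ (T.mem_graph (x - y))
      have h0 : T (x - y) - z • ((x - y : T.domain) : H) = 0 := by
        have hxy' : T x - z • (x : H) = T y - z • (y : H) := hxy
        rw [LinearPMap.map_sub, Submodule.coe_sub, smul_sub, sub_sub_sub_comm, hxy', sub_self]
      simp only [h0, norm_zero, mul_zero, norm_le_zero_iff] at h
      rwa [Submodule.coe_eq_zero, sub_eq_zero] at h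
    · obtain ⟨⟨x, x'⟩, hx, hxy⟩ := h2 y hy
      obtain ⟨w, rfl, rfl⟩ := mem_graph_apply hx
      exact ⟨w, mem_univ _, hxy⟩

/-- A point of the resolvent set has a neighbourhood free of eigenvalues. -/
theorem closure_opEigenvalues_subset_opSpectrum (T : H →ₗ.[𝕜] H) :
    closure (opEigenvalues T) ⊆ opSpectrum T := by
  intro z hz hres
  obtain ⟨-, -, C, hC⟩ := mem_opResolventSet_iff.1 hres
  have key : ∀ l ∈ opEigenvalues T, 1 ≤ C * ‖l - z‖ := by
    intro l hl
    obtain ⟨x, hx, hx0⟩ := (Submodule.ne_bot_iff _).1 hl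
    have h := hC _ (mem_opEigenspace_iff.1 hx)
    simp only [← sub_smul, norm_smul, ← mul_assoc] at h
    have hpos : 0 < ‖x‖ := norm_pos_iff.2 hx0
    exact le_of_mul_le_mul_right (by simpa using h) hpos
  obtain ⟨l, hl, hlim⟩ := mem_closure_iff_seq_limit.1 hz
  have h1 : Tendsto (fun n => C * ‖l n - z‖) atTop (𝓝 (C * ‖z - z‖)) :=
    ((hlim.sub_const z).norm).const_mul C
  have h2 := ge_of_tendsto' h1 fun n => key _ (hl n)
  simp at h2
  linarith

/-- If `p ↦ p.2 - z • p.1` is bounded below on a subspace `g` of `H × H`, the range of its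
restriction to the closure of `g` contains the closure of its range on `g`. -/
theorem exists_mem_topologicalClosure_of_bound [CompleteSpace H] (g : Submodule 𝕜 (H × H)) (z : 𝕜)
    {c : ℝ} (hg : ∀ p ∈ g, ‖p.1‖ ≤ c * ‖p.2 - z • p.1‖) {W : Set H}
    (hW : ∀ y ∈ W, ∃ p ∈ g, p.2 - z • p.1 = y) {y : H} (hy : y ∈ closure W) :
    ∃ p ∈ g.topologicalClosure, p.2 - z • p.1 = y ∧ ‖p.1‖ ≤ c * ‖y‖ := by
  obtain ⟨v, hv, hlim⟩ := mem_closure_iff_seq_limit.1 hy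
  choose p hp hpv using fun n => hW (v n) (hv n)
  have hcauchy : CauchySeq fun n => (p n).1 := by
    have hvc := hlim.cauchySeq
    rw [Metric.cauchySeq_iff'] at hvc ⊢
    intro ε hε
    obtain ⟨N, hN⟩ := hvc (ε / (|c| + 1)) (by positivity)
    refine ⟨N, fun n hn => ?_⟩
    have h1 := hg _ (g.sub_mem (hp n) (hp N))
    have h2 : (p n - p N).2 - z • (p n - p N).1 = v n - v N := by
      rw [← hpv n, ← hpv N, Prod.snd_sub, Prod.fst_sub, smul_sub]
      abel
    rw [h2] at h1
    have h3 := hN n hn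
    rw [dist_eq_norm, lt_div_iff₀ (by positivity)] at h3
    rw [dist_eq_norm]
    calc ‖(p n).1 - (p N).1‖ ≤ c * ‖v n - v N‖ := h1
      _ ≤ (|c| + 1) * ‖v n - v N‖ := by gcongr; linarith [le_abs_self c]
      _ < ε := by rwa [mul_comm]
  obtain ⟨x, hx⟩ := cauchySeq_tendsto_of_complete hcauchy
  have hx2 : Tendsto (fun n => (p n).2) atTop (𝓝 (y + z • x)) := by
    have : (fun n => (p n).2) = fun n => v n + z • (p n).1 := by
      funext n
      rw [← hpv n, sub_add_cancel]
    rw [this]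
    exact hlim.add (hx.const_smul z)
  refine ⟨(x, y + z • x), ?_, by simp, ?_⟩
  · exact mem_closure_iff_seq_limit.2 ⟨p, hp, hx.prodMk_nhds hx2⟩
  · refine le_of_tendsto_of_tendsto' hx.norm (hlim.norm.const_mul c) fun n => ?_
    rw [← hpv n]
    exact hg _ (hp n)

/-- Symmetry of an operator, expressed by its graph. -/
def IsSymmetricGraph (g : Submodule 𝕜 (H × H)) : Prop :=
  ∀ p ∈ g, ∀ q ∈ g, ⟪p.2, q.1⟫_𝕜 = ⟪p.1, q.2⟫_𝕜

theorem IsSelfAdjoint.isSymmetricGraph [CompleteSpace H] {A : H →ₗ.[𝕜] H} (hA : IsSelfAdjoint A) :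
    IsSymmetricGraph A.graph := by
  have h : A.IsFormalAdjoint A := by
    have := LinearPMap.adjoint_isFormalAdjoint hA.dense_domain
    rwa [LinearPMap.isSelfAdjoint_def.1 hA] at this
  rintro ⟨x, x'⟩ hx ⟨y, y'⟩ hy
  obtain ⟨v, rfl, rfl⟩ := mem_graph_apply hx
  obtain ⟨w, rfl, rfl⟩ := mem_graph_apply hy
  exact h v w

/-- Eigenvectors of a symmetric operator for different eigenvalues are orthogonal. -/
theorem orthogonalFamily_opEigenspace {T : H →ₗ.[𝕜] H} (hT : IsSymmetricGraph T.graph) :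
    OrthogonalFamily 𝕜 (fun z => opEigenspace T z) fun z => (opEigenspace T z).subtypeₗᵢ := by
  refine OrthogonalFamily.of_pairwise fun z w hzw => ?_
  rw [Function.onFun, Submodule.isOrtho_iff_inner_eq]
  intro x hx y hy
  have hx' := mem_opEigenspace_iff.1 hx
  have hy' := mem_opEigenspace_iff.1 hy
  by_cases hx0 : x = 0
  · rw [hx0, inner_zero_left]
  have h1 := hT _ hx' _ hx'
  simp only [inner_smul_left, inner_smul_right] at h1
  have hz : (starRingEnd 𝕜) z = z := mul_right_cancel₀ (inner_self_ne_zero.2 hx0) h1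
  have h2 := hT _ hx' _ hy'
  simp only [inner_smul_left, inner_smul_right, hz] at h2
  by_contra hne
  exact hzw (mul_right_cancel₀ hne h2)

/-- A closed symmetric operator whose eigenvectors are total in the closure of its domain has the
closure of the set of eigenvalues as its spectrum: if `z` has distance `δ > 0` from the
eigenvalues, then `‖(T - z) x‖ ≥ δ ‖x‖` on the span of the eigenvectors by Pythagoras, and `T - z`
maps this span onto itself. -/
theorem opSpectrum_eq_closure_opEigenvalues [CompleteSpace H] {T : H →ₗ.[𝕜] H}
    (hT : IsSymmetricGraph T.graph) (hcl : IsClosed (T.graph : Set (H × H)))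
    (hrange : ∀ p ∈ T.graph, p.2 ∈ T.domain.topologicalClosure)
    (htotal : T.domain ≤ (⨆ z, opEigenspace T z).topologicalClosure) :
    opSpectrum T = closure (opEigenvalues T) := by
  refine Subset.antisymm (fun z hz => ?_) (closure_opEigenvalues_subset_opSpectrum T)
  by_contra hzc
  refine hz ?_
  obtain ⟨δ, hδ, hball⟩ := Metric.isOpen_iff.1 isClosed_closure.isOpen_compl z hzc
  have hdist : ∀ l ∈ opEigenvalues T, δ ≤ ‖l - z‖ := by
    intro l hl
    by_contra! h
    exact hball (by rwa [Metric.mem_ball, dist_eq_norm]) (subset_closure hl)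
  set W : Submodule 𝕜 H := ⨆ z, opEigenspace T z with hWdef
  set g : Submodule 𝕜 (H × H) := T.graph ⊓ W.comap (LinearMap.fst 𝕜 H H) with hgdef
  have hgT : g.topologicalClosure ≤ T.graph :=
    Submodule.topologicalClosure_minimal _ inf_le_left hcl
  -- the lower bound on the span of the eigenvectors
  have hbound : ∀ p ∈ g, ‖p.1‖ ≤ δ⁻¹ * ‖p.2 - z • p.1‖ := by
    rintro ⟨x, x'⟩ ⟨hx, hxW⟩
    have hxW' : x ∈ ⨆ z, opEigenspace T z := hxW
    obtain ⟨f, hf, hfx⟩ := (Submodule.mem_iSup_iff_exists_finsupp _ _).1 hxW'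
    have hx' : x' = f.sum fun l v => l • v := by
      refine T.mem_graph_snd_inj hx ?_ rfl
      rw [← hfx]
      have := Submodule.sum_mem T.graph
        (fun l (_ : l ∈ f.support) => mem_opEigenspace_iff.1 (hf l))
      convert! this
      · rw [Prod.fst_sum]; rfl
      · rw [Prod.snd_sum]; rfl
    have hsub : x' - z • x = ∑ l ∈ f.support, (l - z) • f l := by
      rw [hx', ← hfx, Finsupp.sum, Finsupp.sum, Finset.smul_sum, ← Finset.sum_sub_distrib]
      simp only [sub_smul]
    have hfam := orthogonalFamily_opEigenspace hT
    have n1 : ‖x‖ ^ 2 = ∑ l ∈ f.support, ‖f l‖ ^ 2 := by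
      have := hfam.norm_sum (fun l => ⟨f l, hf l⟩) f.support
      simpa [← hfx, Finsupp.sum] using this
    have n2 : ‖x' - z • x‖ ^ 2 = ∑ l ∈ f.support, ‖(l - z) • f l‖ ^ 2 := by
      have := hfam.norm_sum (fun l => ⟨(l - z) • f l, Submodule.smul_mem _ _ (hf l)⟩) f.support
      rw [hsub]
      simpa using this
    have hle : (δ * ‖x‖) ^ 2 ≤ ‖x' - z • x‖ ^ 2 := by
      rw [mul_pow, n1, n2, Finset.mul_sum]
      refine Finset.sum_le_sum fun l hl => ?_
      have hl' : l ∈ opEigenvalues T :=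
        (Submodule.ne_bot_iff _).2 ⟨f l, hf l, Finsupp.mem_support_iff.1 hl⟩
      rw [norm_smul, mul_pow]
      gcongr
      exact hdist l hl'
    have hle' := le_of_sq_le_sq hle (norm_nonneg _)
    rwa [inv_mul_eq_div, le_div_iff₀ hδ, mul_comm]
  have hsurjW : ∀ y ∈ (W : Set H), ∃ p ∈ g, p.2 - z • p.1 = y := by
    intro y hy
    replace hy : y ∈ ⨆ z, opEigenspace T z := hy
    induction hy using Submodule.iSup_induction' with
    | mem l x hx =>
      by_cases hx0 : x = 0
      · exact ⟨0, g.zero_mem, by simp [hx0]⟩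
      have hl : l - z ≠ 0 := by
        have := hdist l ((Submodule.ne_bot_iff _).2 ⟨x, hx, hx0⟩)
        exact norm_pos_iff.1 (hδ.trans_le this)
      have hmem : (l - z)⁻¹ • x ∈ opEigenspace T l := Submodule.smul_mem _ _ hx
      refine ⟨_, ⟨mem_opEigenspace_iff.1 hmem, Submodule.mem_iSup_of_mem l hmem⟩, ?_⟩
      rw [← sub_smul, smul_smul, mul_inv_cancel₀ hl, one_smul]
    | zero => exact ⟨0, g.zero_mem, by simp⟩
    | add x y hx hy ihx ihy =>
      obtain ⟨p, hp, rfl⟩ := ihx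
      obtain ⟨q, hq, rfl⟩ := ihy
      refine ⟨p + q, g.add_mem hp hq, ?_⟩
      rw [Prod.snd_add, Prod.fst_add, smul_add]
      abel
  have hdomW : T.domain.topologicalClosure ≤ W.topologicalClosure :=
    Submodule.topologicalClosure_minimal _ htotal (Submodule.isClosed_topologicalClosure _)
  have hsurj : ∀ y ∈ T.domain.topologicalClosure,
      ∃ p ∈ T.graph, p.2 - z • p.1 = y ∧ ‖p.1‖ ≤ δ⁻¹ * ‖y‖ := by
    intro y hy
    obtain ⟨p, hp, h⟩ := exists_mem_topologicalClosure_of_bound g z hbound hsurjW (hdomW hy)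
    exact ⟨p, hgT hp, h⟩
  have hmaps : ∀ p ∈ T.graph, p.2 - z • p.1 ∈ T.domain.topologicalClosure := by
    intro p hp
    refine Submodule.sub_mem _ (hrange p hp) (Submodule.smul_mem _ _ ?_)
    exact Submodule.le_topologicalClosure _ (LinearPMap.mem_domain_of_mem_graph hp)
  refine mem_opResolventSet_iff.2 ⟨hmaps, fun y hy => ?_, δ⁻¹, fun p hp => ?_⟩
  · obtain ⟨p, hp, h, -⟩ := hsurj y hy
    exact ⟨p, hp, h⟩
  · obtain ⟨q, hq, h, hn⟩ := hsurj _ (hmaps p hp)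
    -- `p - q` is in the graph and killed by `T - z`, and `z` is no eigenvalue
    have hpq : p.1 - q.1 ∈ opEigenspace T z := by
      rw [mem_opEigenspace_iff]
      convert! T.graph.sub_mem hp hq using 1
      refine Prod.ext rfl ?_
      rw [Prod.snd_sub, smul_sub]
      rw [sub_eq_sub_iff_add_eq_add] at h ⊢
      rw [add_comm, ← h, add_comm]
    have hz0 : opEigenspace T z = ⊥ := by
      by_contra hne
      exact hzc (subset_closure hne)
    rw [hz0, Submodule.mem_bot, sub_eq_zero] at hpq
    rw [hpq] at hn ⊢
    exact hn

end Operators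

/-! ### Orthogonal families of subspaces and dimensions -/

section Rank

variable {𝕜 : Type*} [RCLike 𝕜] {H : Type*} [NormedAddCommGroup H] [InnerProductSpace 𝕜 H]

theorem toENat_rank_finset_sup {F : ℕ → Submodule 𝕜 H} (hF : ∀ m n, m ≠ n → F m ⟂ F n)
    (s : Finset ℕ) :
    Cardinal.toENat (Module.rank 𝕜 (s.sup F : Submodule 𝕜 H)) =
      ∑ n ∈ s, Cardinal.toENat (Module.rank 𝕜 (F n)) := by
  induction s using Finset.induction_on with
  | empty => simp
  | insert a s ha ih =>
    rw [Finset.sup_insert, Finset.sum_insert ha, ← ih]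
    have horth : F a ⟂ s.sup F := by
      rw [Finset.sup_eq_iSup]
      simp only [Submodule.isOrtho_iSup_right]
      exact fun n hn => hF _ _ fun h => ha (h ▸ hn)
    have h := Submodule.rank_sup_add_rank_inf_eq (F a) (s.sup F)
    rw [horth.disjoint.eq_bot, rank_bot, add_zero] at h
    rw [h, map_add]

/-- If a subspace `E` is mapped into itself by the projections onto the members `M n` of an
orthogonal family with total span, its dimension is the sum of the dimensions of the `E ⊓ M n`. -/
theorem toENat_rank_eq_tsum {M : ℕ → Submodule 𝕜 H} [∀ n, (M n).HasOrthogonalProjection]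
    (hM : ∀ m n, m ≠ n → M m ⟂ M n) (htot : ∀ x : H, (∀ n, x ∈ (M n)ᗮ) → x = 0)
    {E : Submodule 𝕜 H} (hE : ∀ n, ∀ x ∈ E, (M n).starProjection x ∈ E) :
    Cardinal.toENat (Module.rank 𝕜 E) =
      ∑' n, Cardinal.toENat (Module.rank 𝕜 (E ⊓ M n : Submodule 𝕜 H)) := by
  set F : ℕ → Submodule 𝕜 H := fun n => E ⊓ M n with hFdef
  have hF : ∀ m n, m ≠ n → F m ⟂ F n := fun m n h => (hM m n h).mono inf_le_right inf_le_right
  have hfin : ∀ s : Finset ℕ, ∑ n ∈ s, Cardinal.toENat (Module.rank 𝕜 (F n)) ≤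
      Cardinal.toENat (Module.rank 𝕜 E) := by
    intro s
    rw [← toENat_rank_finset_sup hF]
    exact OrderHomClass.mono Cardinal.toENat
      (Submodule.rank_mono (Finset.sup_le fun n _ => inf_le_left))
  refine (HasSum.tsum_eq (hasSum_of_isLUB _ ⟨?_, ?_⟩)).symm
  · rintro _ ⟨s, rfl⟩
    exact hfin s
  intro b hb
  by_cases hS : {n | F n ≠ ⊥}.Finite
  · -- only finitely many components: they span `E`
    have hEs : E = hS.toFinset.sup F := by
      refine le_antisymm (fun x hx => ?_) (Finset.sup_le fun n _ => inf_le_left)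
      have hx0 : x - ∑ n ∈ hS.toFinset, (M n).starProjection x = 0 := by
        refine htot _ fun m => ?_
        by_cases hm : m ∈ hS.toFinset
        · rw [← Finset.add_sum_erase _ _ hm, ← sub_sub]
          refine Submodule.sub_mem _ (Submodule.sub_starProjection_mem_orthogonal x)
            (Submodule.sum_mem _ fun n hn => ?_)
          exact (hM n m (Finset.ne_of_mem_erase hn)) (Submodule.starProjection_apply_mem _ _)
        · have h0 : (M m).starProjection x = 0 := by
            have hb : F m = ⊥ := by simpa using hm
            have : (M m).starProjection x ∈ F m :=
              ⟨hE m x hx, Submodule.starProjection_apply_mem _ _⟩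
            simpa [hb] using this
          refine Submodule.sub_mem _ ?_ (Submodule.sum_mem _ fun n hn => ?_)
          · have := Submodule.sub_starProjection_mem_orthogonal (K := M m) x
            rwa [h0, sub_zero] at this
          · exact (hM n m fun h => hm (h ▸ hn)) (Submodule.starProjection_apply_mem _ _)
      rw [sub_eq_zero.1 hx0]
      refine Submodule.sum_mem _ fun n hn => ?_
      exact (Finset.le_sup (f := F) hn) ⟨hE n x hx, Submodule.starProjection_apply_mem _ _⟩
    have h := hb ⟨hS.toFinset, rfl⟩
    simp only at h
    rwa [← toENat_rank_finset_sup hF, ← hEs] at h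
  · -- infinitely many nonzero components: both sides are infinite
    have htop : b = ⊤ := by
      refine ENat.eq_top_iff_forall_ge.2 fun k => ?_
      obtain ⟨t, hts, htc⟩ := (Set.not_finite.1 hS).exists_subset_card_eq k
      refine le_trans ?_ (hb ⟨t, rfl⟩)
      rw [← htc, Finset.card_eq_sum_ones, Nat.cast_sum]
      refine Finset.sum_le_sum fun n hn => ?_
      rw [Nat.cast_one, Order.one_le_iff_ne_zero, Ne, Cardinal.toENat_eq_zero, Submodule.rank_eq_zero]
      exact hts hn
    rw [htop]
    exact le_top

theorem orthoDomain_le (D : ℕ → Submodule 𝕜 H) : ∀ n, orthoDomain D n ≤ D n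
  | 0 => le_rfl
  | _ + 1 => inf_le_right

theorem isOrtho_orthoDomain {D : ℕ → Submodule 𝕜 H} (hD : Monotone D) (m n : ℕ)
    (hmn : m ≠ n) : orthoDomain D m ⟂ orthoDomain D n := by
  wlog hlt : m < n generalizing m n
  · exact (this n m hmn.symm (lt_of_le_of_ne (not_lt.1 hlt) hmn.symm)).symm
  obtain ⟨k, rfl⟩ := Nat.exists_eq_succ_of_ne_zero (Nat.ne_zero_of_lt hlt)
  exact (Submodule.isOrtho_orthogonal_right (D k)).mono
    ((orthoDomain_le D m).trans (hD (Nat.lt_succ_iff.1 hlt))) inf_le_left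

end Rank

/-! ### Self-adjoint operators exhausted by operators with compact resolvent -/

section Exhaustion

variable {𝕜 : Type*} [RCLike 𝕜] {H : Type*} [NormedAddCommGroup H] [InnerProductSpace 𝕜 H]
  [CompleteSpace H]

/-- The self-adjoint operator `A` extends operators `T n`, each of which is a nonnegative operator
in a closed subspace `K n` such that `T n + 1` is onto `K n` and the unit ball of the graph norm of
`T n` is relatively compact.  The subspaces `K n` increase to a dense subspace. -/
structure OpExhaustion (T : ℕ → H →ₗ.[𝕜] H) (K : ℕ → Submodule 𝕜 H) (A : H →ₗ.[𝕜] H) :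
    Prop where
  isSelfAdjoint : IsSelfAdjoint A
  le : ∀ n, T n ≤ A
  mono : Monotone K
  isClosed : ∀ n, IsClosed (K n : Set H)
  dense : Dense (⋃ n, (K n : Set H))
  domain_le : ∀ n, (T n).domain ≤ K n
  mem : ∀ n, ∀ p ∈ (T n).graph, p.2 ∈ K n
  nonneg : ∀ n, ∀ p ∈ (T n).graph, 0 ≤ RCLike.re ⟪p.2, p.1⟫_𝕜
  surj : ∀ n, ∀ y ∈ K n, ∃ p ∈ (T n).graph, p.2 + p.1 = y
  compact : ∀ n, ∃ C : Set H, IsCompact C ∧ ∀ p ∈ (T n).graph, ‖p.1‖ ≤ 1 → ‖p.2‖ ≤ 1 → p.1 ∈ C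

namespace OpExhaustion

variable {T : ℕ → H →ₗ.[𝕜] H} {K : ℕ → Submodule 𝕜 H} {A : H →ₗ.[𝕜] H}

theorem graph_le (h : OpExhaustion T K A) (n : ℕ) : (T n).graph ≤ A.graph :=
  LinearPMap.le_graph_of_le (h.le n)

/-- The kernel of `A + 1` is orthogonal to the dense range of `A + 1`. -/
theorem eq_zero_of_mem_graph_neg (h : OpExhaustion T K A) {x : H}
    (hx : (x, -x) ∈ A.graph) : x = 0 := by
  refine h.dense.eq_zero_of_inner_left 𝕜 fun y hy => ?_
  obtain ⟨n, hn⟩ := mem_iUnion.1 hy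
  obtain ⟨p, hp, rfl⟩ := h.surj n y hn
  have := h.isSelfAdjoint.isSymmetricGraph _ hx _ (h.graph_le n hp)
  simp only [inner_neg_left] at this
  rw [inner_add_right, ← this, neg_add_cancel]

theorem eq_of_snd_add_fst_eq (h : OpExhaustion T K A) {p q : H × H} (hp : p ∈ A.graph)
    (hq : q ∈ A.graph) (hpq : p.2 + p.1 = q.2 + q.1) : p = q := by
  have h1 : p.1 - q.1 = 0 := by
    refine h.eq_zero_of_mem_graph_neg ?_
    convert! A.graph.sub_mem hp hq using 1
    refine Prod.ext rfl ?_
    rw [Prod.snd_sub, neg_sub, sub_eq_sub_iff_add_eq_add, add_comm, ← hpq, add_comm]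
  have h1' := sub_eq_zero.1 h1
  refine Prod.ext h1' ?_
  rwa [h1', add_left_inj] at hpq

/-- The operator `T n` is the part of `A` for which `A x + x` lies in `K n`. -/
theorem mem_graph_iff (h : OpExhaustion T K A) (n : ℕ) {p : H × H} :
    p ∈ (T n).graph ↔ p ∈ A.graph ∧ p.2 + p.1 ∈ K n := by
  refine ⟨fun hp => ⟨h.graph_le n hp, (K n).add_mem (h.mem n p hp)
    (h.domain_le n (LinearPMap.mem_domain_of_mem_graph (y := p.2) hp))⟩, fun ⟨hp, hpn⟩ => ?_⟩
  obtain ⟨q, hq, hqp⟩ := h.surj n _ hpn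
  rwa [← h.eq_of_snd_add_fst_eq (h.graph_le n hq) hp hqp]

theorem monotone_graph (h : OpExhaustion T K A) : Monotone fun n => (T n).graph :=
  fun m n hmn p hp => by
    rw [h.mem_graph_iff] at hp ⊢
    exact ⟨hp.1, h.mono hmn hp.2⟩

theorem norm_le (h : OpExhaustion T K A) {n : ℕ} {p : H × H} (hp : p ∈ (T n).graph) :
    ‖p.1‖ ≤ ‖p.2 + p.1‖ := by
  by_cases h0 : p.1 = 0
  · rw [h0, norm_zero]; exact norm_nonneg _
  have h1 := h.nonneg n p hp
  have h2 : ‖p.1‖ * ‖p.1‖ ≤ ‖p.2 + p.1‖ * ‖p.1‖ := by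
    refine le_trans ?_ (re_inner_le_norm (𝕜 := 𝕜) (p.2 + p.1) p.1)
    rw [inner_add_left, map_add, inner_self_eq_norm_mul_norm]
    linarith
  exact le_of_mul_le_mul_right h2 (norm_pos_iff.2 h0)

theorem isClosed_graph (h : OpExhaustion T K A) : IsClosed (A.graph : Set (H × H)) :=
  h.isSelfAdjoint.isClosed

theorem coe_iSup_graph (h : OpExhaustion T K A) :
    ((⨆ n, (T n).graph : Submodule 𝕜 (H × H)) : Set (H × H)) = ⋃ n, ((T n).graph : Set (H × H)) :=
  Submodule.coe_iSup_of_directed _ h.monotone_graph.directed_le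

theorem topologicalClosure_iSup_graph_le (h : OpExhaustion T K A) :
    (⨆ n, (T n).graph).topologicalClosure ≤ A.graph :=
  Submodule.topologicalClosure_minimal _ (iSup_le h.graph_le) h.isClosed_graph

theorem exists_resolvent_apply (h : OpExhaustion T K A) (y : H) :
    ∃ p ∈ (⨆ n, (T n).graph).topologicalClosure, p.2 + p.1 = y ∧ ‖p.1‖ ≤ ‖y‖ := by
  have := exists_mem_topologicalClosure_of_bound (⨆ n, (T n).graph) (-1) (c := 1)
    (W := ⋃ n, (K n : Set H)) (y := y) ?_ ?_ (h.dense y)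
  · simpa using this
  · intro p hp
    rw [← SetLike.mem_coe, h.coe_iSup_graph, mem_iUnion] at hp
    obtain ⟨n, hn⟩ := hp
    simpa using h.norm_le hn
  · intro y hy
    obtain ⟨n, hn⟩ := mem_iUnion.1 hy
    obtain ⟨p, hp, hpy⟩ := h.surj n y hn
    exact ⟨p, Submodule.mem_iSup_of_mem n hp, by simpa using hpy⟩

/-- The union of the operators `T n` is a core for `A`. -/
theorem graph_eq_closure (h : OpExhaustion T K A) :
    (A.graph : Set (H × H)) = closure (⋃ n, ((T n).graph : Set (H × H))) := by
  rw [← h.coe_iSup_graph, ← Submodule.topologicalClosure_coe]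
  refine Subset.antisymm (fun p hp => ?_) h.topologicalClosure_iSup_graph_le
  obtain ⟨q, hq, hqp, -⟩ := h.exists_resolvent_apply (p.2 + p.1)
  have := h.eq_of_snd_add_fst_eq (h.topologicalClosure_iSup_graph_le hq) hp hqp
  rwa [← this]

/-- The resolvent `(A + 1)⁻¹` is an everywhere defined bounded operator. -/
theorem exists_resolvent (h : OpExhaustion T K A) :
    ∃ R : H →L[𝕜] H, ∀ y, (R y, y - R y) ∈ A.graph := by
  choose p hp hpy hpn using h.exists_resolvent_apply
  have hpA : ∀ y, p y ∈ A.graph := fun y => h.topologicalClosure_iSup_graph_le (hp y)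
  let R : H →ₗ[𝕜] H :=
    { toFun := fun y => (p y).1
      map_add' := fun y z => by
        have := h.eq_of_snd_add_fst_eq (hpA (y + z)) (A.graph.add_mem (hpA y) (hpA z))
          (by rw [hpy, Prod.snd_add, Prod.fst_add, add_add_add_comm, hpy, hpy])
        rw [this, Prod.fst_add]
      map_smul' := fun c y => by
        have := h.eq_of_snd_add_fst_eq (hpA (c • y)) (A.graph.smul_mem c (hpA y))
          (by rw [hpy, Prod.smul_snd, Prod.smul_fst, ← smul_add, hpy])
        rw [this, Prod.smul_fst, RingHom.id_apply] }
  refine ⟨R.mkContinuous 1 fun y => by rw [one_mul]; exact hpn y, fun y => ?_⟩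
  have : ((p y).1, y - (p y).1) = p y := Prod.ext rfl (by
    change y - (p y).1 = (p y).2
    rw [sub_eq_iff_eq_add, hpy])
  change ((p y).1, y - (p y).1) ∈ A.graph
  rw [this]
  exact hpA y

/-- The resolvent `(A + 1)⁻¹`. -/
noncomputable def resolvent (h : OpExhaustion T K A) : H →L[𝕜] H :=
  Classical.choose h.exists_resolvent

theorem resolvent_mem_graph (h : OpExhaustion T K A) (y : H) :
    (h.resolvent y, y - h.resolvent y) ∈ A.graph :=
  Classical.choose_spec h.exists_resolvent y

theorem resolvent_eq (h : OpExhaustion T K A) {p : H × H} (hp : p ∈ A.graph) :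
    h.resolvent (p.2 + p.1) = p.1 :=
  congrArg Prod.fst (h.eq_of_snd_add_fst_eq (h.resolvent_mem_graph _) hp (by simp))

theorem resolvent_eq_zero (h : OpExhaustion T K A) {y : H} (hy : h.resolvent y = 0) :
    y = 0 := by
  have := h.resolvent_mem_graph y
  rw [hy, sub_zero] at this
  exact LinearPMap.graph_fst_eq_zero_snd _ this rfl

theorem inner_resolvent (h : OpExhaustion T K A) (y z : H) :
    ⟪h.resolvent y, z⟫_𝕜 = ⟪y, h.resolvent z⟫_𝕜 := by
  have := h.isSelfAdjoint.isSymmetricGraph _ (h.resolvent_mem_graph y) _ (h.resolvent_mem_graph z)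
  simp only [inner_sub_left, inner_sub_right] at this
  exact (sub_left_injective this).symm

theorem resolvent_mem (h : OpExhaustion T K A) {n : ℕ} {y : H} (hy : y ∈ K n) :
    h.resolvent y ∈ K n := by
  obtain ⟨p, hp, rfl⟩ := h.surj n y hy
  rw [h.resolvent_eq (h.graph_le n hp)]
  exact h.domain_le n (LinearPMap.mem_domain_of_mem_graph (y := p.2) hp)

theorem mem_opEigenspace_iff_resolvent (h : OpExhaustion T K A) {z : 𝕜} {x : H} :
    x ∈ opEigenspace A z ↔ x = (z + 1) • h.resolvent x := by
  rw [mem_opEigenspace_iff]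
  constructor
  · intro hx
    have := h.resolvent_eq hx
    have h2 : z • x + x = (z + 1) • x := by rw [add_smul, one_smul]
    rw [h2, map_smul] at this
    exact this.symm
  · intro hx
    have := A.graph.smul_mem (z + 1) (h.resolvent_mem_graph x)
    rw [Prod.smul_mk, smul_sub, ← hx, add_smul, one_smul, add_sub_cancel_right] at this
    exact this

/-! ### Parts of the operator in reducing subspaces -/

/-- `B` is the part of `A` in a closed subspace `M` of some `K n` that is invariant under the
resolvent. -/
structure IsPart (h : OpExhaustion T K A) (M : Submodule 𝕜 H) (B : H →ₗ.[𝕜] H) : Prop where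
  isClosed : IsClosed (M : Set H)
  exists_le : ∃ n, M ≤ K n
  resolvent_mem : ∀ y ∈ M, h.resolvent y ∈ M
  mem_graph_iff : ∀ p : H × H, p ∈ B.graph ↔ p ∈ A.graph ∧ p.2 + p.1 ∈ M

namespace IsPart

variable {h : OpExhaustion T K A} {M : Submodule 𝕜 H} {B : H →ₗ.[𝕜] H}

theorem fst_mem (hB : h.IsPart M B) {p : H × H} (hp : p ∈ B.graph) : p.1 ∈ M := by
  obtain ⟨h1, h2⟩ := (hB.mem_graph_iff p).1 hp
  have := hB.resolvent_mem _ h2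
  rwa [h.resolvent_eq h1] at this

theorem snd_mem (hB : h.IsPart M B) {p : H × H} (hp : p ∈ B.graph) : p.2 ∈ M :=
  (M.add_mem_iff_left (hB.fst_mem hp)).1 ((hB.mem_graph_iff p).1 hp).2

theorem domain_eq (hB : h.IsPart M B) : B.domain = M.map h.resolvent.toLinearMap := by
  ext x
  rw [LinearPMap.mem_domain_iff, Submodule.mem_map]
  constructor
  · rintro ⟨y, hy⟩
    obtain ⟨h1, h2⟩ := (hB.mem_graph_iff _).1 hy
    exact ⟨_, h2, h.resolvent_eq h1⟩
  · rintro ⟨y, hy, rfl⟩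
    refine ⟨y - h.resolvent y, (hB.mem_graph_iff _).2 ⟨h.resolvent_mem_graph y, ?_⟩⟩
    change y - h.resolvent y + h.resolvent y ∈ M
    rwa [sub_add_cancel]

theorem topologicalClosure_domain (hB : h.IsPart M B) : B.domain.topologicalClosure = M := by
  refine le_antisymm (Submodule.topologicalClosure_minimal _ (fun x hx => ?_) hB.isClosed) ?_
  · obtain ⟨y, hy⟩ := LinearPMap.mem_domain_iff.1 hx
    exact hB.fst_mem hy
  -- a vector of `M` orthogonal to the range `R M` is killed by the symmetric operator `R`
  · have : CompleteSpace B.domain.topologicalClosure :=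
      (Submodule.isClosed_topologicalClosure _).completeSpace_coe
    have hle : B.domain.topologicalClosure ≤ M :=
      Submodule.topologicalClosure_minimal _ (fun x hx => by
        obtain ⟨y, hy⟩ := LinearPMap.mem_domain_iff.1 hx
        exact hB.fst_mem hy) hB.isClosed
    intro x hx
    set P := B.domain.topologicalClosure.starProjection
    have hw : x - P x ∈ B.domain.topologicalClosureᗮ := Submodule.sub_starProjection_mem_orthogonal x
    have hwM : x - P x ∈ M := M.sub_mem hx (hle (Submodule.starProjection_apply_mem _ _))
    have hRw : h.resolvent (x - P x) = 0 := by
      have h1 : h.resolvent (x - P x) ∈ M := hB.resolvent_mem _ hwM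
      rw [Submodule.orthogonal_closure, hB.domain_eq] at hw
      have h2 := (Submodule.mem_orthogonal _ _).1 hw _ (Submodule.mem_map_of_mem h1)
      change ⟪h.resolvent (h.resolvent (x - P x)), x - P x⟫_𝕜 = 0 at h2
      rw [h.inner_resolvent] at h2
      exact inner_self_eq_zero.1 h2
    have := sub_eq_zero.1 (h.resolvent_eq_zero hRw)
    rw [this]
    exact Submodule.starProjection_apply_mem _ _

theorem opEigenspace_eq (hB : h.IsPart M B) (z : 𝕜) :
    opEigenspace B z = opEigenspace A z ⊓ M := by
  ext x
  rw [Submodule.mem_inf, mem_opEigenspace_iff, mem_opEigenspace_iff]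
  refine ⟨fun hx => ⟨((hB.mem_graph_iff _).1 hx).1, hB.fst_mem hx⟩, fun ⟨h1, h2⟩ => ?_⟩
  exact (hB.mem_graph_iff _).2 ⟨h1, M.add_mem (M.smul_mem z h2) h2⟩

theorem isClosed_graph (hB : h.IsPart M B) : IsClosed (B.graph : Set (H × H)) := by
  have : (B.graph : Set (H × H)) = (A.graph : Set (H × H)) ∩ (fun p : H × H => p.2 + p.1) ⁻¹' M := by
    ext p
    exact hB.mem_graph_iff p
  rw [this]
  exact h.isClosed_graph.inter (hB.isClosed.preimage (continuous_snd.add continuous_fst))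

theorem isSymmetricGraph (hB : h.IsPart M B) : IsSymmetricGraph B.graph :=
  fun p hp q hq => h.isSelfAdjoint.isSymmetricGraph p ((hB.mem_graph_iff p).1 hp).1 q
    ((hB.mem_graph_iff q).1 hq).1

theorem exists_isCompact (hB : h.IsPart M B) :
    ∃ C : Set H, IsCompact C ∧ ∀ p ∈ B.graph, ‖p.1‖ ≤ 1 → ‖p.2‖ ≤ 1 → p.1 ∈ C := by
  obtain ⟨n, hn⟩ := hB.exists_le
  obtain ⟨C, hC, hCB⟩ := h.compact n
  refine ⟨C, hC, fun p hp => hCB p ((h.mem_graph_iff n).2 ?_)⟩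
  obtain ⟨h1, h2⟩ := (hB.mem_graph_iff p).1 hp
  exact ⟨h1, hn h2⟩

/-- Limits of eigenvalues are eigenvalues: unit eigenvectors for a convergent sequence of
eigenvalues have a convergent subsequence. -/
theorem isClosed_opEigenvalues (hB : h.IsPart M B) : IsClosed (opEigenvalues B) := by
  refine isClosed_of_closure_subset fun z hz => ?_
  obtain ⟨l, hl, hlim⟩ := mem_closure_iff_seq_limit.1 hz
  have hx : ∀ n, ∃ x ∈ opEigenspace B (l n), ‖x‖ = 1 := by
    intro n
    obtain ⟨x, hx, hx0⟩ := (Submodule.ne_bot_iff _).1 (hl n)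
    exact ⟨((‖x‖⁻¹ : ℝ) : 𝕜) • x, Submodule.smul_mem _ _ hx, by
      rw [norm_smul, RCLike.norm_ofReal, abs_of_nonneg (by positivity),
        inv_mul_cancel₀ (norm_ne_zero_iff.2 hx0)]⟩
  choose x hx hx1 using hx
  obtain ⟨C, hC, hCB⟩ := hB.exists_isCompact
  obtain ⟨b, hb⟩ := hlim.norm.bddAbove_range
  have hb' : ∀ n, ‖l n‖ ≤ b := fun n => hb ⟨n, rfl⟩
  -- scaling by `c` puts the eigenvectors into the unit ball of the graph norm
  set c : ℝ := (|b| + 1)⁻¹ with hc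
  have hc0 : 0 < c := by positivity
  have hc1 : c ≤ 1 := inv_le_one_of_one_le₀ (by linarith [abs_nonneg b])
  have hcb : c * b ≤ 1 := by
    rw [hc, inv_mul_eq_div, div_le_one (by positivity)]
    linarith [le_abs_self b]
  have hcx : ∀ n, (c : 𝕜) • x n ∈ C := by
    intro n
    have hmem := mem_opEigenspace_iff.1 (Submodule.smul_mem _ (c : 𝕜) (hx n))
    have hn1 : ‖(c : 𝕜) • x n‖ = c := by
      rw [norm_smul, RCLike.norm_ofReal, abs_of_pos hc0, hx1, mul_one]
    refine hCB _ hmem (hn1.trans_le hc1) ?_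
    rw [norm_smul, hn1, mul_comm]
    exact (mul_le_mul_of_nonneg_left (hb' n) hc0.le).trans hcb
  obtain ⟨y, -, φ, hφ, hy⟩ := hC.tendsto_subseq hcx
  have hyn : ‖y‖ = c := by
    refine tendsto_nhds_unique hy.norm ?_
    have : (fun n => ‖((fun n => (c : 𝕜) • x n) ∘ φ) n‖) = fun _ => c := by
      funext n
      simp [norm_smul, hx1, abs_of_pos hc0]
    rw [this]
    exact tendsto_const_nhds
  refine (Submodule.ne_bot_iff _).2 ⟨y, mem_opEigenspace_iff.2 ?_, ?_⟩
  · refine hB.isClosed_graph.mem_of_tendsto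
      (hy.prodMk_nhds ((hlim.comp hφ.tendsto_atTop).smul hy)) (Eventually.of_forall fun n => ?_)
    exact mem_opEigenspace_iff.1 (Submodule.smul_mem _ (c : 𝕜) (hx (φ n)))
  · rw [← norm_pos_iff, hyn]
    exact hc0

theorem resolvent_starProjection (hB : h.IsPart M B) [M.HasOrthogonalProjection] (x : H) :
    M.starProjection (h.resolvent x) = h.resolvent (M.starProjection x) := by
  refine Submodule.eq_starProjection_of_mem_orthogonal
    (hB.resolvent_mem _ (Submodule.starProjection_apply_mem _ _)) ?_
  rw [← map_sub, Submodule.mem_orthogonal]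
  intro u hu
  rw [← h.inner_resolvent]
  exact (Submodule.mem_orthogonal _ _).1 (Submodule.sub_starProjection_mem_orthogonal x) _
    (hB.resolvent_mem u hu)

theorem starProjection_mem_opEigenspace (hB : h.IsPart M B) [M.HasOrthogonalProjection] {z : 𝕜}
    {x : H} (hx : x ∈ opEigenspace A z) : M.starProjection x ∈ opEigenspace A z := by
  rw [h.mem_opEigenspace_iff_resolvent] at hx ⊢
  rw [← hB.resolvent_starProjection, ← map_smul, ← hx]

/-- The resolvent of a part is compact. -/
theorem isCompactOperator (hB : h.IsPart M B) [M.HasOrthogonalProjection] :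
    IsCompactOperator (h.resolvent ∘L M.starProjection) := by
  obtain ⟨C, hC, hCB⟩ := hB.exists_isCompact
  set N : ℝ := ‖h.resolvent‖ + 1 with hN
  have hN0 : 0 < N := by positivity
  refine ⟨C, hC, Filter.mem_of_superset (Metric.closedBall_mem_nhds 0 (inv_pos.2 hN0))
    fun y hy => ?_⟩
  rw [mem_closedBall_zero_iff] at hy
  have hPy : ‖M.starProjection y‖ ≤ N⁻¹ :=
    ((M.starProjection.le_opNorm y).trans
      (mul_le_of_le_one_left (norm_nonneg _) M.starProjection_norm_le)).trans hy
  have hRP : ‖h.resolvent (M.starProjection y)‖ ≤ ‖h.resolvent‖ * N⁻¹ :=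
    (h.resolvent.le_opNorm _).trans (mul_le_mul_of_nonneg_left hPy (norm_nonneg _))
  have hsum : N⁻¹ + ‖h.resolvent‖ * N⁻¹ = 1 := by
    rw [← one_add_mul, add_comm, ← hN, mul_inv_cancel₀ hN0.ne']
  refine hCB (h.resolvent (M.starProjection y),
    M.starProjection y - h.resolvent (M.starProjection y)) ((hB.mem_graph_iff _).2
      ⟨h.resolvent_mem_graph _, ?_⟩) ?_ ?_
  · simp only [sub_add_cancel]
    exact Submodule.starProjection_apply_mem _ _
  · exact hRP.trans (by linarith [inv_pos.2 hN0])
  · exact (norm_sub_le _ _).trans (by linarith)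

/-- The eigenvectors of a part of `A` are total in its closed subspace, by the spectral theorem
for the compact symmetric operator given by the resolvent of `B` on `M` and by `0` on `Mᗮ`. -/
theorem le_topologicalClosure_iSup (hB : h.IsPart M B) :
    M ≤ (⨆ z, opEigenspace B z).topologicalClosure := by
  have : CompleteSpace M := hB.isClosed.completeSpace_coe
  set Q : H →L[𝕜] H := h.resolvent ∘L M.starProjection with hQ
  have hsymm : Q.IsSymmetric := by
    intro x y
    change ⟪h.resolvent (M.starProjection x), y⟫_𝕜 = ⟪x, h.resolvent (M.starProjection y)⟫_𝕜
    rw [← hB.resolvent_starProjection, ← h.inner_resolvent]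
    exact M.starProjection_isSymmetric _ _
  have hspec := ContinuousLinearMap.orthogonalComplement_iSup_eigenspaces_eq_bot
    hB.isCompactOperator hsymm
  set W : Submodule 𝕜 H := ⨆ z, opEigenspace B z with hW
  have hWM : W.topologicalClosure ≤ M := by
    refine Submodule.topologicalClosure_minimal _ (iSup_le fun z => ?_) hB.isClosed
    rw [hB.opEigenspace_eq]
    exact inf_le_right
  have : CompleteSpace W.topologicalClosure :=
    (Submodule.isClosed_topologicalClosure _).completeSpace_coe
  intro x hx
  set w := x - W.topologicalClosure.starProjection x with hw
  have hwW : w ∈ W.topologicalClosureᗮ := Submodule.sub_starProjection_mem_orthogonal x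
  have hwM : w ∈ M := M.sub_mem hx (hWM (Submodule.starProjection_apply_mem _ _))
  rw [Submodule.orthogonal_closure] at hwW
  have hw0 : w = 0 := by
    rw [← Submodule.mem_bot 𝕜, ← hspec, ← Submodule.iInf_orthogonal, Submodule.mem_iInf]
    intro l
    rw [Submodule.mem_orthogonal]
    intro u hu
    have hu' : h.resolvent (M.starProjection u) = l • u := Module.End.mem_eigenspace_iff.1 hu
    by_cases hl : l = 0
    · rw [hl, zero_smul] at hu'
      have hPu := h.resolvent_eq_zero hu'
      have huM := Submodule.sub_starProjection_mem_orthogonal (K := M) u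
      rw [hPu, sub_zero] at huM
      exact Submodule.inner_left_of_mem_orthogonal hwM huM
    · have huR : u = l⁻¹ • h.resolvent (M.starProjection u) := by
        rw [hu', smul_smul, inv_mul_cancel₀ hl, one_smul]
      have huM : u ∈ M := by
        rw [huR]
        exact M.smul_mem _ (hB.resolvent_mem _ (Submodule.starProjection_apply_mem _ _))
      have huE : u ∈ opEigenspace B (l⁻¹ - 1) := by
        rw [hB.opEigenspace_eq, Submodule.mem_inf, h.mem_opEigenspace_iff_resolvent,
          sub_add_cancel]
        rw [Submodule.starProjection_eq_self_iff.2 huM] at huR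
        exact ⟨huR, huM⟩
      exact Submodule.inner_right_of_mem_orthogonal (Submodule.mem_iSup_of_mem _ huE) hwW
  rw [sub_eq_zero.1 hw0]
  exact Submodule.starProjection_apply_mem _ _

/-- The spectrum of a part of `A` consists of eigenvalues. -/
theorem opSpectrum_eq (hB : h.IsPart M B) : opSpectrum B = opEigenvalues B := by
  rw [← hB.isClosed_opEigenvalues.closure_eq]
  refine opSpectrum_eq_closure_opEigenvalues hB.isSymmetricGraph hB.isClosed_graph ?_ ?_
  · rw [hB.topologicalClosure_domain]
    exact fun p hp => hB.snd_mem hp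
  · refine (Submodule.le_topologicalClosure _).trans ?_
    rw [hB.topologicalClosure_domain]
    exact hB.le_topologicalClosure_iSup

end IsPart

/-! ### The orthogonalized domains -/

theorem isPart_self (h : OpExhaustion T K A) (n : ℕ) : h.IsPart (K n) (T n) where
  isClosed := h.isClosed n
  exists_le := ⟨n, le_rfl⟩
  resolvent_mem _ hy := h.resolvent_mem hy
  mem_graph_iff _ := h.mem_graph_iff n

theorem hasOrthogonalProjection (h : OpExhaustion T K A) (n : ℕ) :
    (K n).HasOrthogonalProjection :=
  have : CompleteSpace (K n) := (h.isClosed n).completeSpace_coe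
  inferInstance

theorem monotone_domain (h : OpExhaustion T K A) : Monotone fun n => (T n).domain :=
  fun m n hmn x hx => by
    obtain ⟨y, hy⟩ := LinearPMap.mem_domain_iff.1 hx
    exact LinearPMap.mem_domain_of_mem_graph (h.monotone_graph hmn hy)

theorem orthogonal_domain (h : OpExhaustion T K A) (n : ℕ) : (T n).domainᗮ = (K n)ᗮ := by
  rw [← Submodule.orthogonal_closure, (h.isPart_self n).topologicalClosure_domain]

theorem resolvent_mem_orthogonal_iff (h : OpExhaustion T K A) {n : ℕ} {y : H} :
    h.resolvent y ∈ (K n)ᗮ ↔ y ∈ (K n)ᗮ := by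
  constructor
  · intro hy
    rw [← h.orthogonal_domain, (h.isPart_self n).domain_eq, Submodule.mem_orthogonal]
    rintro _ ⟨k, hk, rfl⟩
    exact (h.inner_resolvent k y).trans ((Submodule.mem_orthogonal _ _).1 hy k hk)
  · intro hy
    rw [Submodule.mem_orthogonal]
    intro k hk
    rw [← h.inner_resolvent]
    exact (Submodule.mem_orthogonal _ _).1 hy _ (h.resolvent_mem hk)

/-- The resolvent commutes with orthogonalization. -/
theorem orthoDomain_domain (h : OpExhaustion T K A) (n : ℕ) :
    orthoDomain (fun k => (T k).domain) n = (orthoDomain K n).map h.resolvent.toLinearMap := by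
  cases n with
  | zero => exact (h.isPart_self 0).domain_eq
  | succ n =>
    ext x
    simp only [orthoDomain, Submodule.mem_inf, h.orthogonal_domain,
      (h.isPart_self (n + 1)).domain_eq, Submodule.mem_map]
    constructor
    · rintro ⟨h1, y, hy, rfl⟩
      exact ⟨y, ⟨h.resolvent_mem_orthogonal_iff.1 h1, hy⟩, rfl⟩
    · rintro ⟨y, ⟨h1, hy⟩, rfl⟩
      exact ⟨h.resolvent_mem_orthogonal_iff.2 h1, y, hy, rfl⟩

/-- The restriction of `T n` to the orthogonalized domain is the part of `A` in the
orthogonalized subspace. -/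
theorem isPart_domRestrict (h : OpExhaustion T K A) (n : ℕ) :
    h.IsPart (orthoDomain K n)
      ((T n).domRestrict (orthoDomain (fun k => (T k).domain) n)) where
  isClosed := by
    cases n with
    | zero => exact h.isClosed 0
    | succ n => exact (Submodule.isClosed_orthogonal _).inter (h.isClosed _)
  exists_le := ⟨n, orthoDomain_le K n⟩
  resolvent_mem y hy := by
    cases n with
    | zero => exact h.resolvent_mem hy
    | succ n => exact ⟨h.resolvent_mem_orthogonal_iff.2 hy.1, h.resolvent_mem hy.2⟩
  mem_graph_iff p := by
    obtain ⟨x, x'⟩ := p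
    constructor
    · intro hp
      have hpT := LinearPMap.le_graph_of_le LinearPMap.domRestrict_le hp
      have hpA := h.graph_le n hpT
      refine ⟨hpA, ?_⟩
      have hx : x ∈ orthoDomain (fun k => (T k).domain) n :=
        (LinearPMap.mem_domain_of_mem_graph hp).1
      rw [h.orthoDomain_domain] at hx
      obtain ⟨y, hy, hyx⟩ := hx
      have hyx' : h.resolvent (y - (x' + x)) = 0 := by
        rw [map_sub, sub_eq_zero]
        exact hyx.trans (h.resolvent_eq hpA).symm
      change x' + x ∈ orthoDomain K n
      rwa [← sub_eq_zero.1 (h.resolvent_eq_zero hyx')]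
    · rintro ⟨hpA, hxx⟩
      have hpT := (h.mem_graph_iff n).2 ⟨hpA, orthoDomain_le K n hxx⟩
      obtain ⟨y, rfl, rfl⟩ := mem_graph_apply hpT
      have hy : (y : H) ∈ orthoDomain (fun k => (T k).domain) n := by
        rw [h.orthoDomain_domain]
        exact ⟨_, hxx, h.resolvent_eq hpA⟩
      rw [← LinearPMap.domRestrict_apply (f := T n)
        (x := (⟨y, hy, y.2⟩ : ↥(orthoDomain (fun k => (T k).domain) n ⊓ (T n).domain))) rfl]
      exact LinearPMap.mem_graph ((T n).domRestrict (orthoDomain (fun k => (T k).domain) n))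
        ⟨y, hy, y.2⟩

theorem coe_iSup_orthoDomain_domain (h : OpExhaustion T K A) :
    ((⨆ n, orthoDomain (fun k => (T k).domain) n : Submodule 𝕜 H) : Set H) =
      ⋃ n, ((T n).domain : Set H) := by
  rw [← Submodule.coe_iSup_of_directed _ h.monotone_domain.directed_le, SetLike.coe_set_eq]
  refine le_antisymm (iSup_mono fun n => orthoDomain_le _ n) (iSup_le fun n => ?_)
  induction n with
  | zero => exact le_iSup (orthoDomain fun k => (T k).domain) 0
  | succ n ih =>
    have := h.hasOrthogonalProjection n
    rw [(h.isPart_self _).domain_eq]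
    rintro _ ⟨y, hy, rfl⟩
    have hP : (K n).starProjection y ∈ K n := Submodule.starProjection_apply_mem _ _
    rw [← sub_add_cancel y ((K n).starProjection y), map_add]
    refine Submodule.add_mem _ ?_ (ih ?_)
    · refine Submodule.mem_iSup_of_mem (n + 1) ?_
      rw [h.orthoDomain_domain]
      exact Submodule.mem_map_of_mem ⟨Submodule.sub_starProjection_mem_orthogonal y,
        Submodule.sub_mem _ hy (h.mono n.le_succ hP)⟩
    · rw [(h.isPart_self n).domain_eq]
      exact Submodule.mem_map_of_mem hP

theorem eq_zero_of_forall_mem_orthogonal (h : OpExhaustion T K A) {x : H}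
    (hx : ∀ n, x ∈ (orthoDomain K n)ᗮ) : x = 0 := by
  have hK : ∀ n, x ∈ (K n)ᗮ := by
    intro n
    induction n with
    | zero => exact hx 0
    | succ n ih =>
      have := h.hasOrthogonalProjection n
      rw [Submodule.mem_orthogonal]
      intro y hy
      have hP : (K n).starProjection y ∈ K n := Submodule.starProjection_apply_mem _ _
      rw [← sub_add_cancel y ((K n).starProjection y), inner_add_left,
        (Submodule.mem_orthogonal _ _).1 ih _ hP, add_zero]
      exact (Submodule.mem_orthogonal _ _).1 (hx (n + 1)) _
        ⟨Submodule.sub_starProjection_mem_orthogonal y,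
          Submodule.sub_mem _ hy (h.mono n.le_succ hP)⟩
  refine h.dense.eq_zero_of_inner_right 𝕜 fun y hy => ?_
  obtain ⟨n, hn⟩ := mem_iUnion.1 hy
  exact (Submodule.mem_orthogonal _ _).1 (hK n) y hn

theorem hasOrthogonalProjection_orthoDomain (h : OpExhaustion T K A) (n : ℕ) :
    (orthoDomain K n).HasOrthogonalProjection :=
  have : CompleteSpace (orthoDomain K n) := (h.isPart_domRestrict n).isClosed.completeSpace_coe
  inferInstance

theorem opMultiplicity_eq (h : OpExhaustion T K A) (z : 𝕜) :
    opMultiplicity A z = ∑' n, opMultiplicity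
      ((T n).domRestrict (orthoDomain (fun k => (T k).domain) n)) z := by
  have := h.hasOrthogonalProjection_orthoDomain
  have e : ∀ n, opMultiplicity ((T n).domRestrict (orthoDomain (fun k => (T k).domain) n)) z =
      Cardinal.toENat (Module.rank 𝕜 (opEigenspace A z ⊓ orthoDomain K n : Submodule 𝕜 H)) :=
    fun n => by rw [opMultiplicity, (h.isPart_domRestrict n).opEigenspace_eq]
  rw [opMultiplicity, tsum_congr e]
  exact toENat_rank_eq_tsum (isOrtho_orthoDomain h.mono)
    (fun x hx => h.eq_zero_of_forall_mem_orthogonal hx)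
    fun n x hx => (h.isPart_domRestrict n).starProjection_mem_opEigenspace hx

theorem opEigenvalues_eq (h : OpExhaustion T K A) :
    opEigenvalues A = ⋃ n, opEigenvalues
      ((T n).domRestrict (orthoDomain (fun k => (T k).domain) n)) := by
  have := h.hasOrthogonalProjection_orthoDomain
  ext z
  rw [mem_iUnion]
  constructor
  · intro hz
    obtain ⟨x, hx, hx0⟩ := (Submodule.ne_bot_iff _).1 hz
    by_contra! hn
    refine hx0 (h.eq_zero_of_forall_mem_orthogonal fun n => ?_)
    have hb := not_not.1 (hn n)
    rw [(h.isPart_domRestrict n).opEigenspace_eq] at hb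
    have hPx : (orthoDomain K n).starProjection x ∈ opEigenspace A z ⊓ orthoDomain K n :=
      ⟨(h.isPart_domRestrict n).starProjection_mem_opEigenspace hx,
        Submodule.starProjection_apply_mem _ _⟩
    rw [hb, Submodule.mem_bot] at hPx
    have hx' := Submodule.sub_starProjection_mem_orthogonal (K := orthoDomain K n) x
    rwa [hPx, sub_zero] at hx'
  · rintro ⟨n, hz⟩
    obtain ⟨x, hx, hx0⟩ := (Submodule.ne_bot_iff _).1 hz
    rw [(h.isPart_domRestrict n).opEigenspace_eq] at hx
    exact (Submodule.ne_bot_iff _).2 ⟨x, hx.1, hx0⟩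

/-- The eigenvectors of `A` are total, since they are total in each orthogonalized subspace. -/
theorem opSpectrum_eq_closure (h : OpExhaustion T K A) :
    opSpectrum A = closure (opEigenvalues A) := by
  have hdom : A.domain.topologicalClosure = ⊤ :=
    (Submodule.dense_iff_topologicalClosure_eq_top).1 h.isSelfAdjoint.dense_domain
  refine opSpectrum_eq_closure_opEigenvalues h.isSelfAdjoint.isSymmetricGraph h.isClosed_graph
    (fun p _ => by rw [hdom]; trivial) ?_
  have htop : (⨆ z, opEigenspace A z).topologicalClosure = ⊤ := by
    rw [Submodule.topologicalClosure_eq_top_iff, Submodule.eq_bot_iff]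
    intro x hx
    refine h.eq_zero_of_forall_mem_orthogonal fun n => ?_
    refine Submodule.orthogonal_le ((h.isPart_domRestrict n).le_topologicalClosure_iSup) ?_
    rw [Submodule.orthogonal_closure]
    refine Submodule.orthogonal_le (iSup_mono fun z => ?_) hx
    rw [(h.isPart_domRestrict n).opEigenspace_eq]
    exact inf_le_left
  rw [htop]
  exact le_top

end OpExhaustion

end Exhaustion

/-! ### Integration by parts for primitives of integrable functions -/

section IntegrationByParts

variable {𝕜 : Type*} [RCLike 𝕜]

theorem absolutelyContinuousOnInterval_primitive {f : ℝ → 𝕜} {a b : ℝ}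
    (hf : IntervalIntegrable f volume a b) :
    AbsolutelyContinuousOnInterval (fun x => ∫ s in a..x, f s) a b := by
  have h := hf.norm.absolutelyContinuousOnInterval_intervalIntegral (c := a) left_mem_uIcc
  unfold AbsolutelyContinuousOnInterval at h ⊢
  refine squeeze_zero' (Eventually.of_forall fun _ => Finset.sum_nonneg fun _ _ => dist_nonneg)
    ?_ h
  have hev : ∀ᶠ E in AbsolutelyContinuousOnInterval.totalLengthFilter ⊓
      𝓟 (AbsolutelyContinuousOnInterval.disjWithin a b),
      E ∈ AbsolutelyContinuousOnInterval.disjWithin a b :=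
    (eventually_principal.2 fun _ h => h).filter_mono inf_le_right
  filter_upwards [hev] with E hE
  refine Finset.sum_le_sum fun i hi => ?_
  have hsub : ∀ x ∈ uIcc a b, IntervalIntegrable f volume a x := fun x hx =>
    hf.mono_set (uIcc_subset_uIcc left_mem_uIcc hx)
  have h1 := hsub _ (hE.1 i hi).1
  have h2 := hsub _ (hE.1 i hi).2
  rw [dist_comm, dist_comm (∫ s in a..(E.2 i).1, ‖f s‖), dist_eq_norm, dist_eq_norm,
    intervalIntegral.integral_interval_sub_left h2 h1,
    intervalIntegral.integral_interval_sub_left h2.norm h1.norm]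
  exact intervalIntegral.norm_integral_le_abs_integral_norm

theorem AbsolutelyContinuousOnInterval.integral_eq_sub_of_ae_hasDerivAt {f f' : ℝ → 𝕜} {a b : ℝ}
    (hf : AbsolutelyContinuousOnInterval f a b) (hf' : IntervalIntegrable f' volume a b)
    (hderiv : ∀ᵐ x, x ∈ uIcc a b → HasDerivAt f (f' x) x) :
    ∫ s in a..b, f' s = f b - f a := by
  have hg := hf.sub (absolutelyContinuousOnInterval_primitive hf')
  obtain ⟨c, hc⟩ := hg.const_of_ae_hasDerivAt_zero (by
    filter_upwards [hderiv, hf'.ae_hasDerivAt_integral] with x h1 h2 hx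
    have := (h1 hx).sub (h2 hx a left_mem_uIcc)
    rwa [sub_self] at this)
  have ha := hc a left_mem_uIcc
  have hb := hc b right_mem_uIcc
  simp only [Pi.sub_apply, intervalIntegral.integral_same, sub_zero] at ha hb
  rw [ha, ← hb]
  ring

/-- Integration by parts for a `C¹` function `u` and a primitive `v` of an integrable function. -/
theorem integral_deriv_mul_add_mul_of_primitive {l : ℝ} (hl : 0 ≤ l) {u u' v h : ℝ → 𝕜}
    (hu : ∀ t ∈ Icc 0 l, HasDerivWithinAt u (u' t) (Icc 0 l) t) (hu' : ContinuousOn u' (Icc 0 l))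
    (hh : IntervalIntegrable h volume 0 l)
    (hv : ∀ t ∈ Icc 0 l, v t = v 0 + ∫ s in (0 : ℝ)..t, h s) :
    ∫ s in (0 : ℝ)..l, (u' s * v s + u s * h s) = u l * v l - u 0 * v 0 := by
  have hIcc : uIcc 0 l = Icc 0 l := uIcc_of_le hl
  set v' : ℝ → 𝕜 := fun t => v 0 + ∫ s in (0 : ℝ)..t, h s with hv'
  have hacv : AbsolutelyContinuousOnInterval v' 0 l := by
    have hconst : AbsolutelyContinuousOnInterval (fun _ : ℝ => v 0) 0 l :=
      ((LipschitzWith.const (v 0)).lipschitzOnWith (s := uIcc 0 l)).absolutelyContinuousOnInterval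
    exact hconst.add (absolutelyContinuousOnInterval_primitive hh)
  have hacu : AbsolutelyContinuousOnInterval u 0 l := by
    obtain ⟨C, hC⟩ := isCompact_Icc.exists_bound_of_continuousOn hu'
    have : LipschitzOnWith C.toNNReal u (uIcc 0 l) := by
      rw [hIcc]
      refine (convex_Icc 0 l).lipschitzOnWith_of_nnnorm_hasDerivWithin_le hu fun x hx => ?_
      rw [← norm_toNNReal]
      exact Real.toNNReal_le_toNNReal (hC x hx)
    exact this.absolutelyContinuousOnInterval
  have hcu : ContinuousOn u (uIcc 0 l) := hacu.continuousOn
  have hcv : ContinuousOn v' (uIcc 0 l) := hacv.continuousOn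
  have hcu' : ContinuousOn u' (uIcc 0 l) := by rwa [hIcc]
  have hint : IntervalIntegrable (fun s => u' s * v' s + u s * h s) volume 0 l :=
    (hcu'.mul hcv).intervalIntegrable.add (hh.continuousOn_mul hcu)
  have key := (hacu.fun_smul hacv).integral_eq_sub_of_ae_hasDerivAt hint (by
    have hne : ∀ᵐ t : ℝ, t ≠ 0 ∧ t ≠ l := by
      filter_upwards [Measure.ae_ne volume (0 : ℝ), Measure.ae_ne volume l] with t h1 h2
        using ⟨h1, h2⟩
    filter_upwards [hh.ae_hasDerivAt_integral, hne] with x h1 h2 hx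
    rw [hIcc] at hx
    have hx' : x ∈ Ioo 0 l := ⟨lt_of_le_of_ne hx.1 h2.1.symm, lt_of_le_of_ne hx.2 h2.2⟩
    have d1 := (hu x hx).hasDerivAt (Icc_mem_nhds hx'.1 hx'.2)
    have d2 : HasDerivAt v' (h x) x :=
      (h1 (by rwa [hIcc]) 0 left_mem_uIcc).const_add (v 0)
    exact d1.mul d2)
  have hl' : v l = v' l := hv l ⟨hl, le_rfl⟩
  have h0' : v 0 = v' 0 := hv 0 ⟨le_rfl, hl⟩
  rw [hl', h0']
  refine Eq.trans ?_ key
  refine intervalIntegral.integral_congr fun s hs => ?_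
  rw [hv s (by rwa [hIcc] at hs)]

end IntegrationByParts

namespace QuantumGraph

/-! ### The vertices of a finite quantum graph -/

variable (G : QuantumGraph.{u})

/-- The vertices that are end points of an edge. -/
abbrev EndVertex : Type u := {v : G.V // ∃ e, G.src e = v ∨ G.tgt e = v}

/-- The initial vertex of an edge. -/
def source (e : G.E) : G.EndVertex := ⟨G.src e, e, Or.inl rfl⟩

/-- The terminal vertex of an edge. -/
def target (e : G.E) : G.EndVertex := ⟨G.tgt e, e, Or.inr rfl⟩

instance : Finite G.EndVertex := by
  have : Finite G.E := Finite.of_fintype _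
  refine Finite.of_surjective (Sum.elim G.source G.target) ?_
  rintro ⟨v, e, rfl | rfl⟩
  · exact ⟨Sum.inl e, rfl⟩
  · exact ⟨Sum.inr e, rfl⟩

noncomputable instance : Fintype G.EndVertex := Fintype.ofFinite _

theorem exists_weightAt : ∃ W : G.EndVertex → ℝ, ∀ e, W (G.source e) = G.weight e ∧
    W (G.target e) = G.weight e := by
  choose e he using fun v : G.EndVertex => v.2
  refine ⟨fun v => G.weight (e v), fun e' => ⟨G.weight_eq _ _ ?_, G.weight_eq _ _ ?_⟩⟩
  · rcases he (G.source e') with h | h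
    · exact Or.inl h
    · exact Or.inr (Or.inr (Or.inl h))
  · rcases he (G.target e') with h | h
    · exact Or.inr (Or.inl h)
    · exact Or.inr (Or.inr (Or.inr h))

theorem param_of_mem {e : G.E} {t : ℝ} (ht : t ∈ Icc 0 (G.length e)) :
    G.param e t = Quotient.mk G.glue ⟨e, ⟨t, ht⟩⟩ := by
  rw [param, projIcc_of_mem _ ht]

theorem isAt_source (e : G.E) :
    G.IsAt (G.src e) ⟨e, ⟨0, left_mem_Icc.2 (G.length_pos e).le⟩⟩ := Or.inl ⟨rfl, rfl⟩

theorem isAt_target (e : G.E) :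
    G.IsAt (G.tgt e) ⟨e, ⟨G.length e, right_mem_Icc.2 (G.length_pos e).le⟩⟩ := Or.inr ⟨rfl, rfl⟩

theorem exists_pointAt : ∃ P : G.EndVertex → G.Point, ∀ e, P (G.source e) = G.param e 0 ∧
    P (G.target e) = G.param e (G.length e) := by
  have hx : ∀ v : G.EndVertex, ∃ x : G.Segments, G.IsAt v x := by
    rintro ⟨v, e, rfl | rfl⟩
    · exact ⟨_, G.isAt_source e⟩
    · exact ⟨_, G.isAt_target e⟩
  choose x hx using hx
  refine ⟨fun v => Quotient.mk G.glue (x v), fun e => ⟨?_, ?_⟩⟩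
  · rw [G.param_of_mem (left_mem_Icc.2 (G.length_pos e).le)]
    exact Quotient.sound (Or.inr ⟨_, hx _, G.isAt_source e⟩)
  · rw [G.param_of_mem (right_mem_Icc.2 (G.length_pos e).le)]
    exact Quotient.sound (Or.inr ⟨_, hx _, G.isAt_target e⟩)

open Classical in
/-- A sum over edge ends, rearranged as a sum over vertices. -/
theorem sum_source_add_sum_target {M : Type*} [AddCommMonoid M] (a b : G.E → M) :
    ∑ e, (a e + b e) = ∑ v : G.EndVertex,
      ((∑ e, if G.src e = v then a e else 0) + ∑ e, if G.tgt e = v then b e else 0) := by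
  rw [Finset.sum_add_distrib, Finset.sum_add_distrib, Finset.sum_comm,
    Finset.sum_comm (s := (Finset.univ : Finset G.EndVertex))]
  have h1 : ∀ e (v : G.EndVertex), G.src e = v ↔ v = G.source e := fun e v =>
    ⟨fun h => Subtype.ext h.symm, fun h => by rw [h]; rfl⟩
  have h2 : ∀ e (v : G.EndVertex), G.tgt e = v ↔ v = G.target e := fun e v =>
    ⟨fun h => Subtype.ext h.symm, fun h => by rw [h]; rfl⟩
  simp only [h1, h2, Finset.sum_ite_eq', Finset.mem_univ, if_true]

/-! ### Integrals over a quantum graph and the energy identity -/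

instance : IsFiniteMeasure G.measure := by
  unfold measure
  have : ∀ e, IsFiniteMeasure (ENNReal.ofReal (G.weight e) •
      (volume.restrict (Icc (0 : ℝ) (G.length e))).map (G.param e)) := fun e =>
    Measure.smul_finite _ ENNReal.ofReal_ne_top
  infer_instance

theorem integral_eq_sum {E : Type*} [NormedAddCommGroup E] [NormedSpace ℝ E] {F : G.Point → E}
    (hF : Integrable F G.measure) :
    ∫ x, F x ∂G.measure =
      ∑ e, G.weight e • ∫ t in (0 : ℝ)..G.length e, F (G.param e t) := by
  have hle := G.smul_map_param_le
  unfold measure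
  rw [integral_finsetSum_measure fun e _ => hF.mono_measure (hle e)]
  refine Finset.sum_congr rfl fun e _ => ?_
  rw [integral_smul_measure, ENNReal.toReal_ofReal (G.weight_pos e).le,
    integral_map (G.continuous_param e).measurable.aemeasurable,
    intervalIntegral.integral_of_le (G.length_pos e).le, integral_Icc_eq_integral_Ioc]
  exact hF.aestronglyMeasurable.mono_ac (G.map_param_absolutelyContinuous e)

variable {G} {𝕜 : Type*} [RCLike 𝕜]

open Classical in
/-- `g` is in the domain of the Kirchhoff Laplacian with edge derivatives `p` and `h = -g''`. -/
def IsLaplaceTriple (g : G.Point → 𝕜) (p : G.E → ℝ → 𝕜) (h : G.Point → 𝕜) : Prop :=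
  (∀ e, ∀ t ∈ Icc 0 (G.length e),
    HasDerivWithinAt (fun s => g (G.param e s)) (p e t) (Icc 0 (G.length e)) t) ∧
  (∀ e, ∀ t ∈ Icc 0 (G.length e), p e t = p e 0 - ∫ s in (0 : ℝ)..t, h (G.param e s)) ∧
  (∀ v : G.V, (∑ e : G.E, if G.src e = v then p e 0 else 0) +
    (∑ e : G.E, if G.tgt e = v then -p e (G.length e) else 0) = 0)

theorem IsLaplaceTriple.continuousOn {g : G.Point → 𝕜} {p : G.E → ℝ → 𝕜} {h : Lp 𝕜 2 G.measure}
    (H : IsLaplaceTriple g p h) (e : G.E) : ContinuousOn (p e) (Icc 0 (G.length e)) := by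
  have hl := (G.length_pos e).le
  have hint := G.intervalIntegrable_param h e (left_mem_Icc.2 hl) (right_mem_Icc.2 hl)
  have hc := intervalIntegral.continuousOn_primitive_interval' hint left_mem_uIcc
  rw [uIcc_of_le hl] at hc
  exact (continuousOn_const.sub hc).congr fun t ht => H.2.1 e t ht

/-- The energy identity `⟨-g'', g⟩ = ∫ |g'|²`: the boundary terms at the edge ends cancel at each
vertex by continuity and by the Kirchhoff condition. -/
theorem IsLaplaceTriple.re_inner_eq {f h : Lp 𝕜 2 G.measure} {g : G.Point → 𝕜}
    {p : G.E → ℝ → 𝕜} (H : IsLaplaceTriple g p h) (hfg : f =ᵐ[G.measure] g) :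
    RCLike.re ⟪h, f⟫_𝕜 =
      ∑ e, G.weight e * ∫ t in (0 : ℝ)..G.length e, ‖p e t‖ ^ 2 := by
  classical
  have hint : Integrable (fun x => ⟪h x, f x⟫_𝕜) G.measure := L2.integrable_inner h f
  have hstar : ∀ e, ∫ t in (0 : ℝ)..G.length e, ⟪h (G.param e t), f (G.param e t)⟫_𝕜 =
      ((∫ t in (0 : ℝ)..G.length e, ‖p e t‖ ^ 2 : ℝ) : 𝕜) +
        (g (G.param e 0) * (starRingEnd 𝕜) (p e 0) -
          g (G.param e (G.length e)) * (starRingEnd 𝕜) (p e (G.length e))) := by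
    intro e
    have hl := (G.length_pos e).le
    have h0 := left_mem_Icc.2 hl
    have h1 := right_mem_Icc.2 hl
    have hI := G.intervalIntegrable_param h e h0 h1
    have hIc : IntervalIntegrable (fun s => -(starRingEnd 𝕜) (h (G.param e s))) volume 0
        (G.length e) :=
      IntervalIntegrable.neg ⟨(RCLike.conjCLE (K := 𝕜)).toContinuousLinearMap.integrable_comp hI.1,
        (RCLike.conjCLE (K := 𝕜)).toContinuousLinearMap.integrable_comp hI.2⟩
    have hparts := integral_deriv_mul_add_mul_of_primitive (u := fun s => g (G.param e s))
      (v := fun s => (starRingEnd 𝕜) (p e s)) hl (H.1 e) (H.continuousOn e) hIc (by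
        intro t ht
        have hIt := G.intervalIntegrable_param h e h0 ht
        have hcomm := (RCLike.conjCLE (K := 𝕜)).toContinuousLinearMap.intervalIntegral_comp_comm hIt
        have hcomm' : ∫ s in (0 : ℝ)..t, (starRingEnd 𝕜) (h (G.param e s)) =
            (starRingEnd 𝕜) (∫ s in (0 : ℝ)..t, h (G.param e s)) := hcomm
        rw [H.2.1 e t ht, map_sub, intervalIntegral.integral_neg, ← sub_eq_add_neg, hcomm'])
    have hgc : ContinuousOn (fun s => g (G.param e s)) (uIcc 0 (G.length e)) := by
      rw [uIcc_of_le hl]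
      exact fun t ht => (H.1 e t ht).continuousWithinAt
    have hpc : ContinuousOn (p e) (uIcc 0 (G.length e)) := by
      rw [uIcc_of_le hl]
      exact H.continuousOn e
    have hsplit : ∫ s in (0 : ℝ)..G.length e, (p e s * (starRingEnd 𝕜) (p e s) +
        g (G.param e s) * -(starRingEnd 𝕜) (h (G.param e s))) =
        ((∫ t in (0 : ℝ)..G.length e, ‖p e t‖ ^ 2 : ℝ) : 𝕜) -
          ∫ t in (0 : ℝ)..G.length e, ⟪h (G.param e t), f (G.param e t)⟫_𝕜 := by
      have hpp : IntervalIntegrable (fun s => p e s * (starRingEnd 𝕜) (p e s)) volume 0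
          (G.length e) :=
        (hpc.mul (RCLike.continuous_conj.comp_continuousOn hpc)).intervalIntegrable
      rw [intervalIntegral.integral_add hpp (hIc.continuousOn_mul hgc), sub_eq_add_neg]
      congr 1
      · rw [← RCLike.intervalIntegral_ofReal]
        refine intervalIntegral.integral_congr fun s _ => ?_
        simp only [RCLike.mul_conj]
        norm_cast
      · rw [← intervalIntegral.integral_neg]
        refine intervalIntegral.integral_congr_ae_restrict ?_
        have hae := ae_restrict_of_ae_restrict_of_subset (s := uIoc 0 (G.length e))
          (uIoc_subset_uIcc.trans (uIcc_of_le hl).subset) (G.ae_param hfg e)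
        filter_upwards [hae] with s hs
        rw [hs, RCLike.inner_apply, mul_neg]
    rw [hsplit] at hparts
    linear_combination -hparts
  obtain ⟨W, hW⟩ := G.exists_weightAt
  obtain ⟨P, hP⟩ := G.exists_pointAt
  -- the boundary terms, collected at the vertices
  have hbdry : ∑ e, (G.weight e : 𝕜) * (g (G.param e 0) * (starRingEnd 𝕜) (p e 0) -
      g (G.param e (G.length e)) * (starRingEnd 𝕜) (p e (G.length e))) = 0 := by
    have h1 : ∀ e, (G.weight e : 𝕜) * (g (G.param e 0) * (starRingEnd 𝕜) (p e 0) -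
        g (G.param e (G.length e)) * (starRingEnd 𝕜) (p e (G.length e))) =
        (W (G.source e) : 𝕜) * g (P (G.source e)) * (starRingEnd 𝕜) (p e 0) +
        (W (G.target e) : 𝕜) * g (P (G.target e)) * (starRingEnd 𝕜) (-p e (G.length e)) := by
      intro e
      rw [(hW e).1, (hW e).2, (hP e).1, (hP e).2, map_neg]
      ring
    rw [Finset.sum_congr rfl fun e _ => h1 e, sum_source_add_sum_target]
    refine Finset.sum_eq_zero fun v _ => ?_
    have h2 := congrArg (fun x => (W v : 𝕜) * g (P v) * (starRingEnd 𝕜) x) (H.2.2 v)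
    simp only [map_add, map_sum, map_zero, mul_zero, mul_add, Finset.mul_sum] at h2
    refine Eq.trans ?_ h2
    congr 1 <;> refine Finset.sum_congr rfl fun e _ => ?_
    · split_ifs with hv
      · rw [show G.source e = v from Subtype.ext hv]
      · simp
    · split_ifs with hv
      · rw [show G.target e = v from Subtype.ext hv]
      · simp
  have htotal : ⟪h, f⟫_𝕜 =
      ((∑ e, G.weight e * ∫ t in (0 : ℝ)..G.length e, ‖p e t‖ ^ 2 : ℝ) : 𝕜) := by
    rw [L2.inner_def, G.integral_eq_sum hint]
    simp only [hstar, RCLike.real_smul_eq_coe_mul, mul_add, Finset.sum_add_distrib, hbdry, add_zero]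
    push_cast
    rfl
  rw [htotal, RCLike.ofReal_re]

end QuantumGraph

namespace QuantumGraph

variable {G : QuantumGraph.{u}} {𝕜 : Type*} [RCLike 𝕜]

/-! ### Compactness of the unit ball of the graph norm -/

instance : CompactSpace G.Point :=
  have : Finite G.E := Finite.of_fintype _
  inferInstanceAs (CompactSpace (Quotient G.glue))

theorem continuous_of_continuous_edges {X : Type*} [TopologicalSpace X] {g : G.Point → X}
    (hg : ∀ e, Continuous fun t : Icc (0 : ℝ) (G.length e) => g (Quotient.mk G.glue ⟨e, t⟩)) :
    Continuous g :=
  isQuotientMap_quotient_mk'.continuous_iff.2 (continuous_sigma hg)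

theorem continuous_of_continuousOn_param {g : G.Point → 𝕜}
    (hg : ∀ e, ContinuousOn (fun t => g (G.param e t)) (Icc 0 (G.length e))) : Continuous g := by
  refine continuous_of_continuous_edges fun e => ?_
  refine (continuousOn_iff_continuous_domRestrict.1 (hg e)).congr fun t => ?_
  rw [Set.domRestrict_apply, G.param_of_mem t.2]

/-- A family of functions on the graph with a common modulus of continuity along the edges is
equicontinuous, also at the vertices. -/
theorem equicontinuous_of_edges {ι : Type*} {F : ι → G.Point → 𝕜} {D : G.E → ℝ}
    (hF : ∀ i e, ∀ s ∈ Icc 0 (G.length e), ∀ t ∈ Icc 0 (G.length e),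
      ‖F i (G.param e s) - F i (G.param e t)‖ ≤ D e * √|s - t|) : Equicontinuous F := by
  rw [equicontinuous_iff_continuous]
  refine continuous_of_continuous_edges fun e => ?_
  have h : Equicontinuous fun i (t : Icc (0 : ℝ) (G.length e)) =>
      F i (Quotient.mk G.glue ⟨e, t⟩) := by
    refine Metric.equicontinuous_of_continuity_modulus (fun r => D e * √|r|) ?_ _ ?_
    · have : Continuous fun r : ℝ => D e * √|r| := by fun_prop
      simpa using this.tendsto 0
    · intro s t i
      rw [dist_eq_norm, ← G.param_of_mem s.2, ← G.param_of_mem t.2, abs_of_nonneg dist_nonneg,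
        Subtype.dist_eq, Real.dist_eq]
      exact hF i e s s.2 t t.2
  exact equicontinuous_iff_continuous.1 h

theorem weight_mul_integral_le {F : G.E → ℝ} {c : ℝ} (hF : ∀ e, 0 ≤ F e)
    (h : ∑ e, G.weight e * F e ≤ c) (e : G.E) : F e ≤ c / G.weight e := by
  rw [le_div_iff₀ (G.weight_pos e), mul_comm]
  exact (Finset.single_le_sum (f := fun e => G.weight e * F e)
    (fun e _ => mul_nonneg (G.weight_pos e).le (hF e)) (Finset.mem_univ e)).trans h

theorem norm_sq_eq_sum {f : Lp 𝕜 2 G.measure} {g : G.Point → 𝕜} (hfg : f =ᵐ[G.measure] g) :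
    ‖f‖ ^ 2 = ∑ e, G.weight e * ∫ t in (0 : ℝ)..G.length e, ‖g (G.param e t)‖ ^ 2 := by
  have h1 : (‖f‖ ^ 2 : ℝ) = ∫ x, ‖f x‖ ^ 2 ∂G.measure := by
    have := L2.inner_def (𝕜 := 𝕜) f f
    simp only [inner_self_eq_norm_sq_to_K] at this
    have h2 : ∀ x, ((‖f x‖ : 𝕜) ^ 2) = ((‖f x‖ ^ 2 : ℝ) : 𝕜) := fun x => by push_cast; rfl
    simp only [h2, integral_ofReal] at this
    exact_mod_cast this
  have hint : Integrable (fun x => ‖f x‖ ^ 2) G.measure := (Lp.memLp f).integrable_norm_pow two_ne_zero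
  rw [h1, G.integral_eq_sum hint]
  refine Finset.sum_congr rfl fun e _ => ?_
  rw [smul_eq_mul]
  congr 1
  refine intervalIntegral.integral_congr_ae_restrict ?_
  have hl := (G.length_pos e).le
  have hae := ae_restrict_of_ae_restrict_of_subset (s := uIoc 0 (G.length e))
    (uIoc_subset_uIcc.trans (uIcc_of_le hl).subset) (G.ae_param hfg e)
  filter_upwards [hae] with s hs
  rw [hs]

/-- The constant in the Hölder bound for functions in the unit ball of the graph norm. -/
noncomputable def holderConst (G : QuantumGraph.{u}) (e : G.E) : ℝ := (1 / G.weight e + 1) / 2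

theorem holderConst_nonneg (e : G.E) : 0 ≤ G.holderConst e := by
  have := G.weight_pos e
  unfold holderConst
  positivity

theorem IsLaplaceTriple.norm_sub_le {f h : Lp 𝕜 2 G.measure} {g : G.Point → 𝕜}
    {p : G.E → ℝ → 𝕜} (H : IsLaplaceTriple g p h) (hfg : f =ᵐ[G.measure] g) (hf : ‖f‖ ≤ 1)
    (hh : ‖h‖ ≤ 1) (e : G.E) {s t : ℝ} (hs : s ∈ Icc 0 (G.length e))
    (ht : t ∈ Icc 0 (G.length e)) :
    ‖g (G.param e s) - g (G.param e t)‖ ≤ G.holderConst e * √|s - t| := by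
  wlog hst : t ≤ s generalizing s t
  · rw [norm_sub_rev, abs_sub_comm]
    exact this ht hs (not_le.1 hst).le
  rcases hst.eq_or_lt with rfl | hlt
  · simp
  have hsub : Icc t s ⊆ Icc 0 (G.length e) := Icc_subset_Icc ht.1 hs.2
  have hpc : ContinuousOn (p e) (uIcc t s) := by
    rw [uIcc_of_le hst]
    exact (H.continuousOn e).mono hsub
  have hderiv : ∫ r in t..s, p e r = g (G.param e s) - g (G.param e t) := by
    refine intervalIntegral.integral_eq_sub_of_hasDerivAt_of_le
      (f := fun r => g (G.param e r)) hst ?_ ?_ hpc.intervalIntegrable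
    · exact fun r hr => ((H.1 e r (hsub hr)).mono hsub).continuousWithinAt
    · intro r hr
      exact (H.1 e r (hsub (Ioo_subset_Icc_self hr))).hasDerivAt
        (Icc_mem_nhds (ht.1.trans_lt hr.1) (hr.2.trans_le hs.2))
  have hen : ∫ r in (0 : ℝ)..G.length e, ‖p e r‖ ^ 2 ≤ 1 / G.weight e := by
    refine weight_mul_integral_le (F := fun e => ∫ r in (0 : ℝ)..G.length e, ‖p e r‖ ^ 2)
      (fun e => ?_) ?_ e
    · exact intervalIntegral.integral_nonneg (G.length_pos e).le fun r _ => by positivity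
    · rw [← H.re_inner_eq hfg]
      exact (re_inner_le_norm h f).trans (mul_le_one₀ hh (norm_nonneg _) hf)
  have hen' : ∫ r in t..s, ‖p e r‖ ^ 2 ≤ 1 / G.weight e := by
    refine le_trans ?_ hen
    refine intervalIntegral.integral_mono_interval ht.1 hst hs.2
      (Eventually.of_forall fun r => by positivity) ?_
    refine ContinuousOn.intervalIntegrable ?_
    rw [uIcc_of_le (G.length_pos e).le]
    exact (H.continuousOn e).norm.pow 2
  -- weighted arithmetic-geometric mean with weight `a`
  set a := √(s - t) with ha
  have ha0 : 0 < a := Real.sqrt_pos.2 (sub_pos.2 hlt)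
  have haa : a * a = s - t := Real.mul_self_sqrt (sub_pos.2 hlt).le
  rw [← hderiv, abs_of_pos (sub_pos.2 hlt), ← ha]
  calc ‖∫ r in t..s, p e r‖ ≤ ∫ r in t..s, ‖p e r‖ :=
        intervalIntegral.norm_integral_le_integral_norm hst
    _ ≤ ∫ r in t..s, (a / 2 * ‖p e r‖ ^ 2 + 1 / (2 * a)) := by
        refine intervalIntegral.integral_mono_on hst hpc.norm.intervalIntegrable
          ((hpc.norm.pow 2).const_smul (a / 2) |>.add continuousOn_const).intervalIntegrable
          fun r _ => ?_
        have h1 : a / 2 * ‖p e r‖ ^ 2 + 1 / (2 * a) - ‖p e r‖ = (a * ‖p e r‖ - 1) ^ 2 / (2 * a) := by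
          field_simp
          ring
        have h2 : 0 ≤ (a * ‖p e r‖ - 1) ^ 2 / (2 * a) := by positivity
        linarith
    _ = a / 2 * (∫ r in t..s, ‖p e r‖ ^ 2) + (s - t) * (1 / (2 * a)) := by
        have hi : IntervalIntegrable (fun r => a / 2 * ‖p e r‖ ^ 2) volume t s :=
          ((hpc.norm.pow 2).const_smul (a / 2)).intervalIntegrable
        rw [intervalIntegral.integral_add hi intervalIntegrable_const,
          intervalIntegral.integral_const_mul, intervalIntegral.integral_const, smul_eq_mul]
    _ ≤ a / 2 * (1 / G.weight e) + (s - t) * (1 / (2 * a)) := by gcongr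
    _ = G.holderConst e * a := by
        rw [← haa, holderConst]
        field_simp

/-- A uniform bound for functions in the unit ball of the graph norm. -/
noncomputable def supConst (G : QuantumGraph.{u}) (e : G.E) : ℝ :=
  G.holderConst e * √(G.length e) + 1 / 2 + 1 / (2 * G.weight e * G.length e)

theorem supConst_nonneg (e : G.E) : 0 ≤ G.supConst e := by
  have h1 := G.weight_pos e
  have h2 := G.length_pos e
  have h3 := G.holderConst_nonneg e
  unfold supConst
  positivity

theorem IsLaplaceTriple.norm_le {f h : Lp 𝕜 2 G.measure} {g : G.Point → 𝕜}
    {p : G.E → ℝ → 𝕜} (H : IsLaplaceTriple g p h) (hfg : f =ᵐ[G.measure] g) (hf : ‖f‖ ≤ 1)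
    (hh : ‖h‖ ≤ 1) (e : G.E) {t : ℝ} (ht : t ∈ Icc 0 (G.length e)) :
    ‖g (G.param e t)‖ ≤ G.supConst e := by
  have hlpos := G.length_pos e
  have hl := hlpos.le
  have hw := G.weight_pos e
  have hgc : ContinuousOn (fun s => g (G.param e s)) (uIcc 0 (G.length e)) := by
    rw [uIcc_of_le hl]
    exact fun t ht => (H.1 e t ht).continuousWithinAt
  have hL2 : ∫ s in (0 : ℝ)..G.length e, ‖g (G.param e s)‖ ^ 2 ≤ 1 / G.weight e := by
    refine weight_mul_integral_le
      (F := fun e => ∫ s in (0 : ℝ)..G.length e, ‖g (G.param e s)‖ ^ 2) (fun e => ?_) ?_ e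
    · exact intervalIntegral.integral_nonneg (G.length_pos e).le fun r _ => by positivity
    · rw [← norm_sq_eq_sum hfg]
      exact pow_le_one₀ (norm_nonneg _) hf
  set D := G.holderConst e * √(G.length e) with hD
  have hpt : ∀ s ∈ Icc 0 (G.length e),
      ‖g (G.param e t)‖ ≤ (D + 1 / 2) + 1 / 2 * ‖g (G.param e s)‖ ^ 2 := by
    intro s hs
    have h1 := H.norm_sub_le hfg hf hh e ht hs
    have h2 : G.holderConst e * √|t - s| ≤ D := by
      refine mul_le_mul_of_nonneg_left (Real.sqrt_le_sqrt ?_) (G.holderConst_nonneg e)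
      rw [abs_le]
      constructor <;> linarith [ht.1, ht.2, hs.1, hs.2]
    have h3 := norm_le_norm_add_norm_sub' (g (G.param e t)) (g (G.param e s))
    nlinarith [sq_nonneg (‖g (G.param e s)‖ - 1)]
  have hi : IntervalIntegrable (fun s => 1 / 2 * ‖g (G.param e s)‖ ^ 2) volume 0 (G.length e) :=
    ((hgc.norm.pow 2).const_smul (1 / 2 : ℝ)).intervalIntegrable
  have hi' : IntervalIntegrable (fun s => (D + 1 / 2) + 1 / 2 * ‖g (G.param e s)‖ ^ 2) volume 0
      (G.length e) := intervalIntegrable_const.add hi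
  have hmono := intervalIntegral.integral_mono_on hl
    (intervalIntegrable_const (c := ‖g (G.param e t)‖) (μ := volume)) hi' hpt
  rw [intervalIntegral.integral_const, intervalIntegral.integral_add intervalIntegrable_const hi,
    intervalIntegral.integral_const, intervalIntegral.integral_const_mul, smul_eq_mul, smul_eq_mul,
    sub_zero] at hmono
  have hle : G.length e * ‖g (G.param e t)‖ ≤ G.length e * G.supConst e := by
    refine hmono.trans ?_
    have : G.length e * G.supConst e = G.length e * (D + 1 / 2) + 1 / 2 * (1 / G.weight e) := by
      rw [supConst, ← hD]
      field_simp
    rw [this]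
    gcongr
  exact le_of_mul_le_mul_left hle hlpos

/-- The unit ball of the graph norm of the Kirchhoff Laplacian is relatively compact in `L²`, by
the Arzelà–Ascoli theorem. -/
theorem exists_isCompact_unitBall (G : QuantumGraph.{u}) (𝕜 : Type*) [RCLike 𝕜] :
    ∃ C : Set (Lp 𝕜 2 G.measure), IsCompact C ∧
      ∀ q ∈ G.laplacianGraph 𝕜, ‖q.1‖ ≤ 1 → ‖q.2‖ ≤ 1 → q.1 ∈ C := by
  set M := ∑ e, G.supConst e with hM
  set S : Set (BoundedContinuousFunction G.Point 𝕜) := {φ | (∀ x, ‖φ x‖ ≤ M) ∧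
    ∀ e, ∀ s ∈ Icc 0 (G.length e), ∀ t ∈ Icc 0 (G.length e),
      ‖φ (G.param e s) - φ (G.param e t)‖ ≤ G.holderConst e * √|s - t|} with hS
  have hcomp : IsCompact (closure S) :=
    BoundedContinuousFunction.arzela_ascoli (Metric.closedBall 0 M)
      (isCompact_closedBall _ _) S (fun φ x hφ => mem_closedBall_zero_iff.2 (hφ.1 x))
      (equicontinuous_of_edges fun φ => φ.2.2)
  refine ⟨_, hcomp.image (BoundedContinuousFunction.toLp 2 G.measure 𝕜).continuous, ?_⟩
  rintro ⟨f, h⟩ ⟨g, hfg, p, H⟩ hf hh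
  have H' : IsLaplaceTriple g p h := H
  have hg : Continuous g := continuous_of_continuousOn_param fun e t ht =>
    (H'.1 e t ht).continuousWithinAt
  set φ : BoundedContinuousFunction G.Point 𝕜 := BoundedContinuousFunction.mkOfCompact ⟨g, hg⟩
  refine ⟨φ, subset_closure ⟨fun x => ?_, fun e s hs t ht => H'.norm_sub_le hfg hf hh e hs ht⟩, ?_⟩
  · induction x using Quotient.inductionOn with
    | h x =>
      obtain ⟨e, t, ht⟩ := x
      rw [← G.param_of_mem ht]
      exact (H'.norm_le hfg hf hh e ht).trans
        (Finset.single_le_sum (fun e _ => G.supConst_nonneg e) (Finset.mem_univ e))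
  · refine Lp.ext ?_
    refine (BoundedContinuousFunction.coeFn_toLp (p := 2) (𝕜 := 𝕜) G.measure φ).trans ?_
    exact hfg.symm

end QuantumGraph

/-! ### The equation `-u'' + u = h` on an interval -/

section IntervalEquation

variable {𝕜 : Type*} [RCLike 𝕜]

theorem RCLike.hasDerivAt_ofReal_comp {f : ℝ → ℝ} {f' t : ℝ} (hf : HasDerivAt f f' t) :
    HasDerivAt (fun s => (f s : 𝕜)) (f' : 𝕜) t :=
  (RCLike.ofRealCLM (K := 𝕜)).hasFDerivAt.comp_hasDerivAt t hf

theorem hasDerivWithinAt_primitive_Icc {f : ℝ → 𝕜} {l t : ℝ} (hf : ContinuousOn f (Icc 0 l))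
    (ht : t ∈ Icc 0 l) :
    HasDerivWithinAt (fun x => ∫ s in (0 : ℝ)..x, f s) (f t) (Icc 0 l) t := by
  have : Fact (t ∈ Icc 0 l) := ⟨ht⟩
  refine intervalIntegral.integral_hasDerivWithinAt_right ?_
    (hf.stronglyMeasurableAtFilter_nhdsWithin measurableSet_Icc t) (hf t ht)
  refine (hf.mono ?_).intervalIntegrable
  rw [uIcc_of_le ht.1]
  exact Icc_subset_Icc_right ht.2

theorem hasDerivAt_cosh_add_sinh (a b : 𝕜) (t : ℝ) :
    HasDerivAt (fun s => a * (Real.cosh s : 𝕜) + b * (Real.sinh s : 𝕜))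
      (a * (Real.sinh t : 𝕜) + b * (Real.cosh t : 𝕜)) t :=
  ((RCLike.hasDerivAt_ofReal_comp (Real.hasDerivAt_cosh t)).const_mul a).add
    ((RCLike.hasDerivAt_ofReal_comp (Real.hasDerivAt_sinh t)).const_mul b)

theorem continuous_cosh_add_sinh (a b : 𝕜) :
    Continuous fun s : ℝ => a * (Real.cosh s : 𝕜) + b * (Real.sinh s : 𝕜) :=
  continuous_iff_continuousAt.2 fun t => (hasDerivAt_cosh_add_sinh a b t).continuousAt

theorem integral_cosh_add_sinh (a b : 𝕜) (t : ℝ) :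
    ∫ s in (0 : ℝ)..t, (a * (Real.cosh s : 𝕜) + b * (Real.sinh s : 𝕜)) =
      a * (Real.sinh t : 𝕜) + b * (Real.cosh t : 𝕜) - b := by
  have := intervalIntegral.integral_eq_sub_of_hasDerivAt (a := 0) (b := t)
    (fun s _ => hasDerivAt_cosh_add_sinh b a s)
    (by simpa only [add_comm] using (continuous_cosh_add_sinh a b).intervalIntegrable 0 t)
  simpa [add_comm] using this

/-- The solution of `-u'' + u = h` on `[0, l]` with `u(0) = a` and `u'(0) = b`, by variation of
parameters. -/
theorem exists_solution_Icc {l : ℝ} (hl : 0 ≤ l) {h : ℝ → 𝕜} (hh : IntervalIntegrable h volume 0 l) :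
    ∃ w q : ℝ → 𝕜, w 0 = 0 ∧ ∀ a b : 𝕜,
      (∀ t ∈ Icc 0 l, HasDerivWithinAt
        (fun t => w t + (a * (Real.cosh t : 𝕜) + b * (Real.sinh t : 𝕜)))
        (q t + (a * (Real.sinh t : 𝕜) + b * (Real.cosh t : 𝕜))) (Icc 0 l) t) ∧
      ∀ t ∈ Icc 0 l, q t + (a * (Real.sinh t : 𝕜) + b * (Real.cosh t : 𝕜)) = q 0 + b -
        ∫ s in (0 : ℝ)..t,
          (h s - (w s + (a * (Real.cosh s : 𝕜) + b * (Real.sinh s : 𝕜)))) := by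
  set ch : ℝ → 𝕜 := fun t => (Real.cosh t : 𝕜) with hch
  set sh : ℝ → 𝕜 := fun t => (Real.sinh t : 𝕜) with hsh
  have dch : ∀ t, HasDerivAt ch (sh t) t := fun t =>
    RCLike.hasDerivAt_ofReal_comp (Real.hasDerivAt_cosh t)
  have dsh : ∀ t, HasDerivAt sh (ch t) t := fun t =>
    RCLike.hasDerivAt_ofReal_comp (Real.hasDerivAt_sinh t)
  have cch : Continuous ch := RCLike.continuous_ofReal.comp Real.continuous_cosh
  have csh : Continuous sh := RCLike.continuous_ofReal.comp Real.continuous_sinh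
  have hpyth : ∀ t, ch t * ch t - sh t * sh t = 1 := fun t => by
    have := Real.cosh_sq_sub_sinh_sq t
    simp only [hch, hsh]
    rw [← sq, ← sq]
    exact_mod_cast this
  have hint : ∀ t ∈ Icc 0 l, IntervalIntegrable h volume 0 t := fun t ht => by
    refine hh.mono_set ?_
    rw [uIcc_of_le hl, uIcc_of_le ht.1]
    exact Icc_subset_Icc_right ht.2
  set C : ℝ → 𝕜 := fun t => ∫ s in (0 : ℝ)..t, ch s * h s with hC
  set S : ℝ → 𝕜 := fun t => ∫ s in (0 : ℝ)..t, sh s * h s with hS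
  have iC : IntervalIntegrable (fun s => ch s * h s) volume 0 l :=
    hh.continuousOn_mul cch.continuousOn
  have iS : IntervalIntegrable (fun s => sh s * h s) volume 0 l :=
    hh.continuousOn_mul csh.continuousOn
  have cC : ContinuousOn C (Icc 0 l) := by
    rw [← uIcc_of_le hl]
    exact intervalIntegral.continuousOn_primitive_interval' iC left_mem_uIcc
  have cS : ContinuousOn S (Icc 0 l) := by
    rw [← uIcc_of_le hl]
    exact intervalIntegral.continuousOn_primitive_interval' iS left_mem_uIcc
  -- integration by parts of a hyperbolic function against `C` or `S`
  have parts : ∀ {u u' k : ℝ → 𝕜}, (∀ t, HasDerivAt u (u' t) t) → Continuous u' →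
      Continuous k → ∀ t ∈ Icc 0 l,
      ∫ s in (0 : ℝ)..t, (u' s * (∫ r in (0 : ℝ)..s, k r * h r) + u s * (k s * h s)) =
        u t * ∫ r in (0 : ℝ)..t, k r * h r := by
    intro u u' k hu hu' hk t ht
    have := integral_deriv_mul_add_mul_of_primitive (h := fun s => k s * h s)
      (v := fun s => ∫ r in (0 : ℝ)..s, k r * h r) ht.1
      (fun s _ => (hu s).hasDerivWithinAt) hu'.continuousOn
      ((hint t ht).continuousOn_mul hk.continuousOn) (fun s _ => by simp)
    rwa [intervalIntegral.integral_same, mul_zero, sub_zero] at this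
  have subIcc : ∀ t ∈ Icc 0 l, uIcc 0 t ⊆ Icc 0 l := fun t ht => by
    rw [uIcc_of_le ht.1]
    exact Icc_subset_Icc_right ht.2
  have ii : ∀ {u' u k : ℝ → 𝕜}, Continuous u' → Continuous u → Continuous k → ∀ t ∈ Icc 0 l,
      IntervalIntegrable (fun s => u' s * (∫ r in (0 : ℝ)..s, k r * h r) + u s * (k s * h s))
        volume 0 t := by
    intro u' u k hu' hu hk t ht
    have i1 : ContinuousOn (fun s => ∫ r in (0 : ℝ)..s, k r * h r) (uIcc 0 t) :=
      intervalIntegral.continuousOn_primitive_interval'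
        ((hint t ht).continuousOn_mul hk.continuousOn) left_mem_uIcc
    exact (hu'.continuousOn.mul i1).intervalIntegrable.add
      (((hint t ht).continuousOn_mul hk.continuousOn).continuousOn_mul hu.continuousOn)
  set w : ℝ → 𝕜 := fun t => ch t * S t - sh t * C t with hw
  set q : ℝ → 𝕜 := fun t => sh t * S t - ch t * C t with hq
  have cq : ContinuousOn q (Icc 0 l) := (csh.continuousOn.mul cS).sub (cch.continuousOn.mul cC)
  have cw : ContinuousOn w (Icc 0 l) := (cch.continuousOn.mul cS).sub (csh.continuousOn.mul cC)
  have hwq : ∀ t ∈ Icc 0 l, w t = ∫ s in (0 : ℝ)..t, q s := by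
    intro t ht
    have e1 := parts dch csh csh t ht
    have e2 := parts dsh cch cch t ht
    simp only [hw, hC, hS]
    rw [← e1, ← e2, ← intervalIntegral.integral_sub (ii csh cch csh t ht) (ii cch csh cch t ht)]
    refine intervalIntegral.integral_congr fun s _ => ?_
    simp only [hq, hC, hS]
    ring
  have hqw : ∀ t ∈ Icc 0 l, q t = -∫ s in (0 : ℝ)..t, (h s - w s) := by
    intro t ht
    have e1 := parts dsh cch csh t ht
    have e2 := parts dch csh cch t ht
    simp only [hq, hC, hS]
    rw [← e1, ← e2, ← intervalIntegral.integral_sub (ii cch csh csh t ht) (ii csh cch cch t ht),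
      ← intervalIntegral.integral_neg]
    refine intervalIntegral.integral_congr fun s _ => ?_
    simp only [hw, hC, hS]
    linear_combination (-h s) * hpyth s
  have hq0 : q 0 = 0 := by simp [hq, hC, hS]
  refine ⟨w, q, by simp [hw, hC, hS], fun a b => ⟨fun t ht => ?_, fun t ht => ?_⟩⟩
  · have d1 : HasDerivWithinAt w (q t) (Icc 0 l) t :=
      (hasDerivWithinAt_primitive_Icc cq ht).congr hwq (hwq t ht)
    exact d1.add (hasDerivAt_cosh_add_sinh a b t).hasDerivWithinAt
  · have chom : Continuous fun s => a * ch s + b * sh s := continuous_cosh_add_sinh a b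
    have e1 : ∫ s in (0 : ℝ)..t, (a * ch s + b * sh s) = a * sh t + b * ch t - b :=
      integral_cosh_add_sinh a b t
    have iw : IntervalIntegrable w volume 0 t := (cw.mono (subIcc t ht)).intervalIntegrable
    have e2 : ∫ s in (0 : ℝ)..t, (h s - (w s + (a * ch s + b * sh s))) =
        (∫ s in (0 : ℝ)..t, (h s - w s)) - ∫ s in (0 : ℝ)..t, (a * ch s + b * sh s) := by
      rw [← intervalIntegral.integral_sub ((hint t ht).sub iw) (chom.intervalIntegrable _ _)]
      refine intervalIntegral.integral_congr fun s _ => ?_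
      ring
    change q t + (a * sh t + b * ch t) =
      q 0 + b - ∫ s in (0 : ℝ)..t, (h s - (w s + (a * ch s + b * sh s)))
    rw [e2, e1, hqw t ht, hq0]
    ring

end IntervalEquation

namespace QuantumGraph

/-! ### Surjectivity of the Kirchhoff Laplacian plus one -/

variable {G : QuantumGraph.{u}}

/-- Functions on the edges that agree at the vertices define a function on the graph. -/
theorem exists_glue {X : Type*} {u : G.E → ℝ → X} {c : G.EndVertex → X}
    (h0 : ∀ e, u e 0 = c (G.source e))
    (hl : ∀ e, u e (G.length e) = c (G.target e)) :
    ∃ g : G.Point → X, ∀ e, ∀ t ∈ Icc 0 (G.length e), g (G.param e t) = u e t := by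
  have hat : ∀ (v : G.V) (x : G.Segments), G.IsAt v x → ∃ hv, u x.1 x.2 = c ⟨v, hv⟩ := by
    rintro v ⟨e, t⟩ (⟨ht, rfl⟩ | ⟨ht, rfl⟩)
    · refine ⟨⟨e, Or.inl rfl⟩, ?_⟩
      simp only at ht ⊢
      rw [ht]
      exact h0 e
    · refine ⟨⟨e, Or.inr rfl⟩, ?_⟩
      simp only at ht ⊢
      rw [ht]
      exact hl e
  refine ⟨Quotient.lift (fun x : G.Segments => u x.1 x.2) ?_, fun e t ht => ?_⟩
  · rintro x y (rfl | ⟨v, hx, hy⟩)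
    · rfl
    · obtain ⟨_, h1⟩ := hat v x hx
      obtain ⟨_, h2⟩ := hat v y hy
      rw [h1, h2]
  · rw [G.param_of_mem ht]
    rfl

variable {𝕜 : Type*} [RCLike 𝕜]

open Classical in
/-- A solution of `-u'' + u = h` on the edges that is continuous and satisfies the Kirchhoff
condition at the vertices gives an element of the graph of the Kirchhoff Laplacian. -/
theorem exists_mem_laplacianGraph {h : Lp 𝕜 2 G.measure} {u q : G.E → ℝ → 𝕜}
    {c : G.EndVertex → 𝕜} (h0 : ∀ e, u e 0 = c (G.source e))
    (hl : ∀ e, u e (G.length e) = c (G.target e))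
    (hu : ∀ e, ∀ t ∈ Icc 0 (G.length e),
      HasDerivWithinAt (u e) (q e t) (Icc 0 (G.length e)) t)
    (hq : ∀ e, ∀ t ∈ Icc 0 (G.length e),
      q e t = q e 0 - ∫ s in (0 : ℝ)..t, (h (G.param e s) - u e s))
    (hK : ∀ v : G.EndVertex, (∑ e : G.E, if G.src e = v then q e 0 else 0) +
      (∑ e : G.E, if G.tgt e = v then -q e (G.length e) else 0) = 0) :
    ∃ f : Lp 𝕜 2 G.measure, (f, h - f) ∈ G.laplacianGraph 𝕜 ∧
      ∀ e, ∀ᵐ t ∂(volume.restrict (Icc (0 : ℝ) (G.length e))), f (G.param e t) = u e t := by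
  obtain ⟨g, hg⟩ := exists_glue h0 hl
  have hgd : ∀ e, ∀ t ∈ Icc 0 (G.length e),
      HasDerivWithinAt (fun s => g (G.param e s)) (q e t) (Icc 0 (G.length e)) t :=
    fun e t ht => (hu e t ht).congr (fun s hs => hg e s hs) (hg e t ht)
  have hgc : Continuous g :=
    continuous_of_continuousOn_param fun e t ht => (hgd e t ht).continuousWithinAt
  set φ : BoundedContinuousFunction G.Point 𝕜 := BoundedContinuousFunction.mkOfCompact ⟨g, hgc⟩
  set f : Lp 𝕜 2 G.measure := BoundedContinuousFunction.toLp 2 G.measure 𝕜 φ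
  have hfg : f =ᵐ[G.measure] g :=
    BoundedContinuousFunction.coeFn_toLp (p := 2) (𝕜 := 𝕜) G.measure φ
  have hfu : ∀ e, ∀ᵐ t ∂(volume.restrict (Icc (0 : ℝ) (G.length e))),
      f (G.param e t) = u e t := fun e => by
    filter_upwards [G.ae_param hfg e, ae_restrict_mem measurableSet_Icc] with t h1 h2
    rw [h1, hg e t h2]
  refine ⟨f, ⟨g, hfg, q, hgd, fun e t ht => ?_, fun v => ?_⟩, hfu⟩
  · rw [hq e t ht]
    congr 1
    refine intervalIntegral.integral_congr_ae_restrict ?_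
    have hsub : uIoc 0 t ⊆ Icc 0 (G.length e) := uIoc_subset_uIcc.trans
      (uIcc_subset_Icc (left_mem_Icc.2 (G.length_pos e).le) ht)
    filter_upwards [ae_restrict_of_ae_restrict_of_subset hsub (hfu e),
      ae_restrict_of_ae_restrict_of_subset hsub (G.ae_param (Lp.coeFn_sub h f) e)] with s h1 h2
    rw [h2, Pi.sub_apply, h1]
  · by_cases hv : ∃ e, G.src e = v ∨ G.tgt e = v
    · exact hK ⟨v, hv⟩
    · push Not at hv
      simp [fun e => (hv e).1, fun e => (hv e).2]

theorem re_inner_nonneg_of_mem_laplacianGraph {x : Lp 𝕜 2 G.measure × Lp 𝕜 2 G.measure}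
    (hx : x ∈ G.laplacianGraph 𝕜) : 0 ≤ RCLike.re ⟪x.2, x.1⟫_𝕜 := by
  obtain ⟨g, hg, p, H⟩ := hx
  have H' : IsLaplaceTriple g p x.2 := H
  rw [H'.re_inner_eq hg]
  exact Finset.sum_nonneg fun e _ => mul_nonneg (G.weight_pos e).le
    (intervalIntegral.integral_nonneg (G.length_pos e).le fun t _ => by positivity)

open Classical in
/-- The linear system for the solution of `-u'' + u = h` on the graph, in terms of the initial
values `a` and initial derivatives `b` on the edges and the values `c` at the vertices: the
mismatches of `u` with `c` at the two ends of each edge, and the defect in the Kirchhoff condition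
at each vertex. -/
noncomputable def vertexSystem (G : QuantumGraph.{u}) (𝕜 : Type*) [RCLike 𝕜] :
    ((G.E → 𝕜) × (G.E → 𝕜) × (G.EndVertex → 𝕜)) →ₗ[𝕜]
      ((G.E → 𝕜) × (G.E → 𝕜) × (G.EndVertex → 𝕜)) where
  toFun x :=
    (fun e => x.1 e - x.2.2 (G.source e),
      fun e => x.1 e * (Real.cosh (G.length e) : 𝕜) + x.2.1 e * (Real.sinh (G.length e) : 𝕜) -
        x.2.2 (G.target e),
      fun v => (∑ e : G.E, if G.src e = v then x.2.1 e else 0) +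
        ∑ e : G.E, if G.tgt e = v then
          -(x.1 e * (Real.sinh (G.length e) : 𝕜) + x.2.1 e * (Real.cosh (G.length e) : 𝕜)) else 0)
  map_add' x y := by
    refine Prod.ext ?_ (Prod.ext ?_ ?_)
    · funext e
      simp only [Prod.fst_add, Prod.snd_add, Pi.add_apply]
      ring
    · funext e
      simp only [Prod.fst_add, Prod.snd_add, Pi.add_apply]
      ring
    · funext v
      simp only [Prod.fst_add, Prod.snd_add, Pi.add_apply]
      refine Eq.trans ?_ (add_add_add_comm _ _ _ _)
      refine congrArg₂ (· + ·) ?_ ?_ <;> rw [← Finset.sum_add_distrib] <;>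
        refine Finset.sum_congr rfl fun e _ => ?_ <;> split_ifs <;> ring
  map_smul' k x := by
    refine Prod.ext ?_ (Prod.ext ?_ ?_)
    · funext e
      simp only [Prod.smul_fst, Prod.smul_snd, Pi.smul_apply, smul_eq_mul, RingHom.id_apply]
      ring
    · funext e
      simp only [Prod.smul_fst, Prod.smul_snd, Pi.smul_apply, smul_eq_mul, RingHom.id_apply]
      ring
    · funext v
      simp only [Prod.smul_fst, Prod.smul_snd, Pi.smul_apply, smul_eq_mul, RingHom.id_apply,
        mul_add, Finset.mul_sum]
      congr 1 <;> refine Finset.sum_congr rfl fun e _ => ?_ <;> split_ifs <;> ring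

/-- A solution of the homogeneous system would be a function with `Δu + u = 0`, which vanishes
since the Kirchhoff Laplacian `Δ` is nonnegative. -/
theorem injective_vertexSystem : Function.Injective (G.vertexSystem 𝕜) := by
  classical
  rw [← LinearMap.ker_eq_bot, LinearMap.ker_eq_bot']
  rintro ⟨a, b, c⟩ habc
  have ha : ∀ e, a e - c (G.source e) = 0 := fun e => congrFun (congrArg Prod.fst habc) e
  have hb : ∀ e, a e * (Real.cosh (G.length e) : 𝕜) + b e * (Real.sinh (G.length e) : 𝕜) -
      c (G.target e) = 0 := fun e => congrFun (congrArg (fun x => x.2.1) habc) e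
  have hK : ∀ v : G.EndVertex, (∑ e : G.E, if G.src e = v then b e else 0) +
      (∑ e : G.E, if G.tgt e = v then -(a e * (Real.sinh (G.length e) : 𝕜) +
        b e * (Real.cosh (G.length e) : 𝕜)) else 0) = 0 :=
    fun v => congrFun (congrArg (fun x => x.2.2) habc) v
  set u : G.E → ℝ → 𝕜 := fun e t => a e * (Real.cosh t : 𝕜) + b e * (Real.sinh t : 𝕜) with hu
  have hu0 : ∀ e, u e 0 = c (G.source e) := fun e => by simp [hu, sub_eq_zero.1 (ha e)]
  have hul : ∀ e, u e (G.length e) = c (G.target e) := fun e => sub_eq_zero.1 (hb e)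
  obtain ⟨f, hf, hfu⟩ := exists_mem_laplacianGraph (h := (0 : Lp 𝕜 2 G.measure)) (u := u)
    (q := fun e t => a e * (Real.sinh t : 𝕜) + b e * (Real.cosh t : 𝕜)) hu0 hul
    (fun e t _ => (hasDerivAt_cosh_add_sinh (a e) (b e) t).hasDerivWithinAt)
    (fun e t ht => by
      have hI : ∫ s in (0 : ℝ)..t, ((0 : Lp 𝕜 2 G.measure) (G.param e s) - u e s) =
          ∫ s in (0 : ℝ)..t, -u e s := by
        refine intervalIntegral.integral_congr_ae_restrict ?_
        have hsub : uIoc 0 t ⊆ Icc 0 (G.length e) := uIoc_subset_uIcc.trans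
          (uIcc_subset_Icc (left_mem_Icc.2 (G.length_pos e).le) ht)
        filter_upwards [ae_restrict_of_ae_restrict_of_subset hsub
          (G.ae_param (Lp.coeFn_zero 𝕜 2 G.measure) e)] with s hs
        rw [hs, Pi.zero_apply, zero_sub]
      rw [hI, intervalIntegral.integral_neg, integral_cosh_add_sinh]
      simp)
    (fun v => by simpa using hK v)
  have hf0 : f = 0 := by
    have h1 := re_inner_nonneg_of_mem_laplacianGraph hf
    simp only [zero_sub, inner_neg_left, map_neg, inner_self_eq_norm_sq] at h1
    have h2 : ‖f‖ ^ 2 = 0 := le_antisymm (by linarith) (sq_nonneg _)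
    exact norm_eq_zero.1 (pow_eq_zero_iff two_ne_zero |>.1 h2)
  have hzero : ∀ e, ∀ t ∈ Icc 0 (G.length e), u e t = 0 := by
    intro e
    refine Measure.eqOn_Icc_of_ae_eq volume (G.length_pos e).ne ?_
      (continuous_cosh_add_sinh (a e) (b e)).continuousOn continuousOn_const
    filter_upwards [hfu e, G.ae_param (Lp.coeFn_zero 𝕜 2 G.measure) e] with t h1 h2
    rw [← h1, hf0, h2, Pi.zero_apply]
  have h0 := fun e => hzero e 0 (left_mem_Icc.2 (G.length_pos e).le)
  have hl := fun e => hzero e (G.length e) (right_mem_Icc.2 (G.length_pos e).le)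
  have ha0 : ∀ e, a e = 0 := fun e => by simpa [hu] using h0 e
  refine Prod.ext (funext ha0) (Prod.ext (funext fun e => ?_) (funext fun v => ?_))
  · have h1 := hl e
    simp only [hu, ha0, zero_mul, zero_add, mul_eq_zero, RCLike.ofReal_eq_zero] at h1
    exact h1.resolve_right (Real.sinh_pos_iff.2 (G.length_pos e)).ne'
  · obtain ⟨v, e, rfl | rfl⟩ := v
    · exact (hu0 e).symm.trans (h0 e)
    · exact (hul e).symm.trans (hl e)

/-- The Kirchhoff Laplacian plus one is onto. -/
theorem exists_mem_laplacianGraph_add_eq (h : Lp 𝕜 2 G.measure) :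
    ∃ x ∈ G.laplacianGraph 𝕜, x.2 + x.1 = h := by
  classical
  have hex := fun e => exists_solution_Icc (G.length_pos e).le (G.intervalIntegrable_param h e
    (left_mem_Icc.2 (G.length_pos e).le) (right_mem_Icc.2 (G.length_pos e).le))
  choose w q hw0 hsol using hex
  obtain ⟨⟨a, b, c⟩, habc⟩ := LinearMap.injective_iff_surjective.1
    (injective_vertexSystem (G := G) (𝕜 := 𝕜)) (0, fun e => -w e (G.length e),
      fun v => -((∑ e : G.E, if G.src e = v then q e 0 else 0) +
        ∑ e : G.E, if G.tgt e = v then -q e (G.length e) else 0))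
  have ha : ∀ e, a e - c (G.source e) = 0 := fun e => congrFun (congrArg Prod.fst habc) e
  have hb : ∀ e, a e * (Real.cosh (G.length e) : 𝕜) + b e * (Real.sinh (G.length e) : 𝕜) -
      c (G.target e) = -w e (G.length e) := fun e => congrFun (congrArg (fun x => x.2.1) habc) e
  have hK : ∀ v : G.EndVertex, (∑ e : G.E, if G.src e = v then b e else 0) +
      (∑ e : G.E, if G.tgt e = v then -(a e * (Real.sinh (G.length e) : 𝕜) +
        b e * (Real.cosh (G.length e) : 𝕜)) else 0) =
      -((∑ e : G.E, if G.src e = v then q e 0 else 0) +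
        ∑ e : G.E, if G.tgt e = v then -q e (G.length e) else 0) :=
    fun v => congrFun (congrArg (fun x => x.2.2) habc) v
  have h0 : ∀ e, w e 0 + (a e * (Real.cosh 0 : 𝕜) + b e * (Real.sinh 0 : 𝕜)) =
      c (G.source e) := fun e => by simp [hw0, sub_eq_zero.1 (ha e)]
  have hl : ∀ e, w e (G.length e) + (a e * (Real.cosh (G.length e) : 𝕜) +
      b e * (Real.sinh (G.length e) : 𝕜)) = c (G.target e) := fun e => by
    linear_combination hb e
  obtain ⟨f, hf, -⟩ := exists_mem_laplacianGraph (h := h)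
    (u := fun e t => w e t + (a e * (Real.cosh t : 𝕜) + b e * (Real.sinh t : 𝕜)))
    (q := fun e t => q e t + (a e * (Real.sinh t : 𝕜) + b e * (Real.cosh t : 𝕜))) (c := c)
    h0 hl (fun e => (hsol e (a e) (b e)).1)
    (fun e t ht => by simpa using (hsol e (a e) (b e)).2 t ht) (fun v => by
      have h1 := hK v
      rw [eq_neg_iff_add_eq_zero, add_add_add_comm, ← Finset.sum_add_distrib,
        ← Finset.sum_add_distrib] at h1
      refine Eq.trans ?_ h1
      congr 1
      · refine Finset.sum_congr rfl fun e _ => ?_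
        split_ifs
        · simp [add_comm]
        · simp
      · refine Finset.sum_congr rfl fun e _ => ?_
        split_ifs
        · ring
        · simp)
  exact ⟨_, hf, sub_add_cancel h f⟩

end QuantumGraph

/-! ### Transport of operators along isometries -/

section Transport

variable {𝕜 : Type*} [RCLike 𝕜] {H K : Type*} [NormedAddCommGroup H] [InnerProductSpace 𝕜 H]
  [NormedAddCommGroup K] [InnerProductSpace 𝕜 K]

theorem mem_graph_transportOp_iff {U : K →ₗᵢ[𝕜] H} {T : K →ₗ.[𝕜] K} {p : H × H} :
    p ∈ (transportOp U T).graph ↔ ∃ q ∈ T.graph, U q.1 = p.1 ∧ U q.2 = p.2 := by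
  have happly : ∀ (x : T.domain) (hx : U (x : K) ∈ (transportOp U T).domain),
      transportOp U T ⟨U x, hx⟩ = U (T x) := by
    intro x hx
    have : (Submodule.equivMapOfInjective U.toLinearMap U.injective T.domain).symm ⟨U x, hx⟩ =
        x := by
      rw [LinearEquiv.symm_apply_eq]
      rfl
    change U (T ((Submodule.equivMapOfInjective U.toLinearMap U.injective T.domain).symm
      ⟨U x, hx⟩)) = U (T x)
    rw [this]
  obtain ⟨x, x'⟩ := p
  constructor
  · intro h
    obtain ⟨⟨_, y, hy, rfl⟩, rfl, rfl⟩ := mem_graph_apply h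
    exact ⟨_, T.mem_graph ⟨y, hy⟩, rfl, (happly ⟨y, hy⟩ _).symm⟩
  · rintro ⟨⟨y, y'⟩, hq, h1, h2⟩
    obtain ⟨z, rfl, rfl⟩ := mem_graph_apply hq
    have hz : U (z : K) ∈ (transportOp U T).domain := Submodule.mem_map_of_mem z.2
    have := LinearPMap.mem_graph (transportOp U T) ⟨U z, hz⟩
    rw [happly] at this
    simp only at h1 h2
    rwa [← h1, ← h2]

end Transport

namespace QuantumGraphSystem

/-! ### Square integrable functions on the limit space -/

variable {S : QuantumGraphSystem.{u}} {μ : Measure S.Limit}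

theorem generateFrom_proj : (inferInstance : MeasurableSpace S.Limit) =
    MeasurableSpace.generateFrom {t | ∃ n, ∃ s, MeasurableSet s ∧ S.proj n ⁻¹' s = t} := by
  refine le_antisymm ?_ ?_
  · change MeasurableSpace.comap Subtype.val (⨆ n, MeasurableSpace.comap _ _) ≤ _
    rw [MeasurableSpace.comap_iSup]
    refine iSup_le fun n => ?_
    rw [MeasurableSpace.comap_comp]
    rintro t ⟨s, hs, rfl⟩
    exact MeasurableSpace.measurableSet_generateFrom ⟨n, s, hs, rfl⟩
  · refine MeasurableSpace.generateFrom_le ?_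
    rintro t ⟨n, s, hs, rfl⟩
    exact ((measurable_pi_apply n).comp measurable_subtype_coe) hs

theorem map_proj (n : ℕ) : S.map n ∘ S.proj (n + 1) = S.proj n := funext fun x => x.2 n

theorem exists_preimage_of_le {m n : ℕ} (hmn : m ≤ n) {s : Set (S.F m).Point}
    (hs : MeasurableSet s) :
    ∃ t : Set (S.F n).Point, MeasurableSet t ∧ S.proj n ⁻¹' t = S.proj m ⁻¹' s := by
  induction n, hmn using Nat.le_induction with
  | base => exact ⟨s, hs, rfl⟩
  | succ n _ ih =>
    obtain ⟨t, ht, hts⟩ := ih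
    refine ⟨S.map n ⁻¹' t, (S.continuous_map n).measurable ht, ?_⟩
    rw [← preimage_comp, map_proj, hts]

theorem isPiSystem_proj :
    IsPiSystem {t : Set S.Limit | ∃ n, ∃ s, MeasurableSet s ∧ S.proj n ⁻¹' s = t} := by
  rintro _ ⟨m, s, hs, rfl⟩ _ ⟨n, t, ht, rfl⟩ -
  obtain ⟨s', hs', h1⟩ := exists_preimage_of_le (le_max_left m n) hs
  obtain ⟨t', ht', h2⟩ := exists_preimage_of_le (le_max_right m n) ht
  exact ⟨max m n, s' ∩ t', hs'.inter ht', by rw [preimage_inter, h1, h2]⟩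

theorem IsLimitMeasure.isFiniteMeasure (hμ : S.IsLimitMeasure μ) : IsFiniteMeasure μ := by
  refine ⟨?_⟩
  have := (hμ 0).measure_preimage MeasurableSet.univ.nullMeasurableSet
  rw [preimage_univ] at this
  rw [this]
  exact measure_lt_top _ _

variable (𝕜 : Type*) [RCLike 𝕜]

/-- The closed subspace of `L²` of the limit space consisting of the functions that factor through
the projection to `F n`. -/
noncomputable def cylinderSpace (hμ : S.IsLimitMeasure μ) (n : ℕ) : Submodule 𝕜 (Lp 𝕜 2 μ) :=
  LinearMap.range (Lp.compMeasurePreservingₗᵢ 𝕜 (p := 2) (E := 𝕜) (S.proj n) (hμ n)).toLinearMap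

variable {𝕜} (hμ : S.IsLimitMeasure μ)

theorem isClosed_cylinderSpace (n : ℕ) :
    IsClosed (S.cylinderSpace 𝕜 hμ n : Set (Lp 𝕜 2 μ)) :=
  (Lp.compMeasurePreservingₗᵢ 𝕜 (p := 2) (E := 𝕜) (S.proj n)
    (hμ n)).isometry.isClosedEmbedding.isClosed_range

theorem monotone_cylinderSpace : Monotone (S.cylinderSpace 𝕜 hμ) := by
  refine monotone_nat_of_le_succ fun n => ?_
  rintro _ ⟨f, rfl⟩
  refine ⟨Lp.compMeasurePreserving (S.map n) (S.measurePreserving_map n) f, ?_⟩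
  refine Lp.ext ?_
  refine (Lp.coeFn_compMeasurePreserving _ (hμ (n + 1))).trans ?_
  refine Filter.EventuallyEq.trans ?_ (Lp.coeFn_compMeasurePreserving f (hμ n)).symm
  have := (hμ (n + 1)).quasiMeasurePreserving.ae_eq_comp
    (Lp.coeFn_compMeasurePreserving f (S.measurePreserving_map n))
  rwa [Function.comp_assoc, map_proj] at this

/-- A function orthogonal to all cylinder functions has integral zero over every cylinder set,
hence over every measurable set. -/
theorem dense_iUnion_cylinderSpace :
    Dense (⋃ n, (S.cylinderSpace 𝕜 hμ n : Set (Lp 𝕜 2 μ))) := by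
  have := hμ.isFiniteMeasure
  rw [← Submodule.coe_iSup_of_directed _ (monotone_cylinderSpace hμ).directed_le,
    Submodule.dense_iff_topologicalClosure_eq_top, Submodule.topologicalClosure_eq_top_iff,
    Submodule.eq_bot_iff]
  intro w hw
  have hint : Integrable w μ := (Lp.memLp w).integrable (by norm_num)
  have hcyl : ∀ n, ∀ s : Set (S.F n).Point, MeasurableSet s →
      ∫ x in S.proj n ⁻¹' s, w x ∂μ = 0 := by
    intro n s hs
    have hmem : indicatorConstLp 2 ((hμ n).measurable hs) (measure_ne_top μ _) (1 : 𝕜) ∈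
        S.cylinderSpace 𝕜 hμ n := by
      refine ⟨indicatorConstLp 2 hs (measure_ne_top _ _) (1 : 𝕜), ?_⟩
      exact Lp.indicatorConstLp_compMeasurePreserving hs (measure_ne_top _ _) 1 (hμ n)
    rw [← L2.inner_indicatorConstLp_one (𝕜 := 𝕜) ((hμ n).measurable hs) (measure_ne_top μ _)]
    exact (Submodule.mem_orthogonal _ _).1 hw _ (Submodule.mem_iSup_of_mem n hmem)
  have hall : ∀ s, MeasurableSet s → ∫ x in s, w x ∂μ = 0 := by
    intro s hs
    induction s, hs using MeasurableSpace.induction_on_inter generateFrom_proj isPiSystem_proj with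
    | empty => simp
    | basic t ht =>
      obtain ⟨n, s, hs, rfl⟩ := ht
      exact hcyl n s hs
    | compl t ht ih =>
      have h1 := integral_add_compl ht hint
      have h2 := hcyl 0 univ MeasurableSet.univ
      rw [preimage_univ, setIntegral_univ] at h2
      rwa [ih, zero_add, h2] at h1
    | iUnion f hd hf ih =>
      rw [integral_iUnion hf hd hint.integrableOn]
      simp [ih]
  exact (Lp.eq_zero_iff_ae_eq_zero).2
    (hint.ae_eq_zero_of_forall_setIntegral_eq_zero fun s hs _ => hall s hs)

/-! ### The limit of the Kirchhoff Laplacians -/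

theorem mem_graph_pullbackLaplacian_iff {n : ℕ} {x : Lp 𝕜 2 μ × Lp 𝕜 2 μ} :
    x ∈ (S.pullbackLaplacian 𝕜 hμ n).graph ↔ ∃ q ∈ (S.F n).laplacianGraph 𝕜,
      Lp.compMeasurePreservingₗᵢ 𝕜 (S.proj n) (hμ n) q.1 = x.1 ∧
      Lp.compMeasurePreservingₗᵢ 𝕜 (S.proj n) (hμ n) q.2 = x.2 := by
  rw [pullbackLaplacian, mem_graph_transportOp_iff, QuantumGraph.graph_laplacian]

/-- A self-adjoint common extension of the Kirchhoff Laplacians is exhausted by them. -/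
theorem opExhaustion {A : Lp 𝕜 2 μ →ₗ.[𝕜] Lp 𝕜 2 μ} (hA : IsSelfAdjoint A)
    (hle : ∀ n, S.pullbackLaplacian 𝕜 hμ n ≤ A) :
    OpExhaustion (S.pullbackLaplacian 𝕜 hμ) (S.cylinderSpace 𝕜 hμ) A where
  isSelfAdjoint := hA
  le := hle
  mono := monotone_cylinderSpace hμ
  isClosed := isClosed_cylinderSpace hμ
  dense := dense_iUnion_cylinderSpace hμ
  domain_le n x hx := by
    obtain ⟨y, hy⟩ := LinearPMap.mem_domain_iff.1 hx
    obtain ⟨q, -, h1, -⟩ := (mem_graph_pullbackLaplacian_iff hμ).1 hy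
    exact ⟨_, h1⟩
  mem n p hp := by
    obtain ⟨q, -, -, h2⟩ := (mem_graph_pullbackLaplacian_iff hμ).1 hp
    exact ⟨_, h2⟩
  nonneg n p hp := by
    obtain ⟨q, hq, h1, h2⟩ := (mem_graph_pullbackLaplacian_iff hμ).1 hp
    rw [← h1, ← h2, LinearIsometry.inner_map_map]
    exact QuantumGraph.re_inner_nonneg_of_mem_laplacianGraph hq
  surj n y hy := by
    obtain ⟨f, rfl⟩ := hy
    obtain ⟨q, hq, rfl⟩ := QuantumGraph.exists_mem_laplacianGraph_add_eq f
    refine ⟨(Lp.compMeasurePreservingₗᵢ 𝕜 (S.proj n) (hμ n) q.1,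
      Lp.compMeasurePreservingₗᵢ 𝕜 (S.proj n) (hμ n) q.2),
      (mem_graph_pullbackLaplacian_iff hμ).2 ⟨q, hq, rfl, rfl⟩, ?_⟩
    exact (map_add (Lp.compMeasurePreservingₗᵢ 𝕜 (S.proj n) (hμ n)) q.2 q.1).symm
  compact n := by
    obtain ⟨C, hC, hCq⟩ := (S.F n).exists_isCompact_unitBall 𝕜
    refine ⟨_, hC.image (Lp.compMeasurePreservingₗᵢ 𝕜 (S.proj n) (hμ n)).continuous, ?_⟩
    intro p hp hp1 hp2
    obtain ⟨q, hq, h1, h2⟩ := (mem_graph_pullbackLaplacian_iff hμ).1 hp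
    rw [← h1, LinearIsometry.norm_map] at hp1
    rw [← h2, LinearIsometry.norm_map] at hp2
    exact ⟨q.1, hCq q hq hp1 hp2, h1⟩

end QuantumGraphSystem

theorem mainTheorem2 (𝕜 : Type*) [RCLike 𝕜] (S : QuantumGraphSystem.{u})
    (μ : Measure S.Limit) (hμ : S.IsLimitMeasure μ)
    (A : Lp 𝕜 2 μ →ₗ.[𝕜] Lp 𝕜 2 μ)
    (hA : IsProjectiveLimitOp (S.pullbackLaplacian 𝕜 hμ) A) :
    -- the orthogonal decomposition of the union of the domains
    (∀ m n, m ≠ n → S.orthoDom 𝕜 hμ m ⟂ S.orthoDom 𝕜 hμ n) ∧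
    ((⨆ n, S.orthoDom 𝕜 hμ n : Submodule 𝕜 (Lp 𝕜 2 μ)) : Set (Lp 𝕜 2 μ)) =
      ⋃ n, ((S.pullbackLaplacian 𝕜 hμ n).domain : Set (Lp 𝕜 2 μ)) ∧
    -- the union of the domains is dense in the domain of `A` for the graph norm
    (A.graph : Set (Lp 𝕜 2 μ × Lp 𝕜 2 μ)) =
      closure (⋃ n, ((S.pullbackLaplacian 𝕜 hμ n).graph : Set (Lp 𝕜 2 μ × Lp 𝕜 2 μ))) ∧
    -- each restriction is an operator in the Hilbert space `closure (D' n)`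
    (∀ n (x : (S.restrictedLaplacian 𝕜 hμ n).domain),
      S.restrictedLaplacian 𝕜 hμ n x ∈ (S.orthoDom 𝕜 hμ n).topologicalClosure) ∧
    -- the spectrum, as the set of eigenvalues, with multiplicities adding
    opEigenvalues A = ⋃ n, opSpectrum (S.restrictedLaplacian 𝕜 hμ n) ∧
    (∀ z : 𝕜, opMultiplicity A z = ∑' n, opMultiplicity (S.restrictedLaplacian 𝕜 hμ n) z) ∧
    -- the spectrum, as the complement of the resolvent set
    opSpectrum A = closure (⋃ n, opSpectrum (S.restrictedLaplacian 𝕜 hμ n)) := by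
  have h := QuantumGraphSystem.opExhaustion hμ hA.isSelfAdjoint hA.le
  have hpart : ∀ n, h.IsPart _ (S.restrictedLaplacian 𝕜 hμ n) := h.isPart_domRestrict
  have heig : opEigenvalues A = ⋃ n, opSpectrum (S.restrictedLaplacian 𝕜 hμ n) := by
    rw [h.opEigenvalues_eq]
    exact iUnion_congr fun n => ((hpart n).opSpectrum_eq).symm
  refine ⟨fun m n => isOrtho_orthoDomain h.monotone_domain m n, h.coe_iSup_orthoDomain_domain,
    h.graph_eq_closure, fun n x => ?_, heig, h.opMultiplicity_eq, ?_⟩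
  · have hdom : (S.restrictedLaplacian 𝕜 hμ n).domain = S.orthoDom 𝕜 hμ n :=
      inf_eq_left.2 (orthoDomain_le _ n)
    rw [← hdom, (hpart n).topologicalClosure_domain]
    exact (hpart n).snd_mem (LinearPMap.mem_graph _ x)
  · rw [← heig]
    exact h.opSpectrum_eq_closure
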